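/- Let $p$ be a prime and $q\ge 0$ an integer, and consider an infinite chain with $q$ qudits of dimension $p$ at each site of $\mathbb Z$. The Pauli group $\mathcal P$ of the chain is generated by the operators $X=\sum_{j}|j+1 \bmod p\rangle\langle j|$ and $Z=\sum_j e^{2\pi i j/p}|j\rangle\langle j|$ on single qudits, together with the scalars in an arbitrary fixed subgroup $\Gamma$ of $U(1)$ (for instance $\Gamma=\{1\}$, $\Gamma=\{\pm1,\pm i\}$, or $\Gamma=U(1)$); in particular all its elements have finite support. (1) Let $G\subseteq\mathcal P$ be a subgroup that is invariant under all translations of $\mathbb Z$. Then there is an abelian subgroup $\mathcal S\subseteq\mathcal P$, every element of which commutes with every element of $G$, such that: (a) $\mathcal S$ is generated by a set of Pauli operators which, for some integer $b\ge1$, is invariant under all translations by multiples of $b$, and which is local, i.e. for some $\ell$ each of its elements is supported on an interval of length $\ell$; (b) every element of $\mathcal P$ that commutes with all elements of $\mathcal S$ and all elements of $G$ belongs to $\mathcal S$. (2) Let $R=\mathbb F_p[x,x^{-1}]$, and for an integer $b\ge 1$ let $R_b=\mathbb F_p[x^{b},x^{-b}]\subseteq R$. On $R^{2q}$ let $\langle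 v,w\rangle\in\mathbb F_p$ be the coefficient of $x^0$ in $v^\dagger\lambda_q w$, where $\lambda_q=\begin{pmatrix}0&I_q\\-I_q&0\end{pmatrix}$ and $\dagger$ is transposition followed by $x\mapsto x^{-1}$, and let $M^\perp=\{v\in R^{2q}:\langle u,v\rangle=0\text{ for all }u\in M\}$ for $M\subseteq R^{2q}$. Then for every $R$-submodule $A$ of $R^{2q}$ there exist an integer $b\ge1$ and a free $R_b$-submodule $\mathcal S$ of $R^{2q}$ with $\mathcal S\subseteq A^\perp$ and $\mathcal S^\perp\cap A^\perp=\mathcal S$. -/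

import Mathlib

open scoped LaurentPolynomial

noncomputable section

namespace PauliChain

/-! ### Pauli operators on a one-dimensional chain -/

section Operators

/-- Computational basis states of a chain with `q` qudits of dimension `p` at every site of `ℤ`;
the qudits are labelled by pairs (site, position in the unit cell). -/
abbrev Config (p q : ℕ) : Type := ℤ × Fin q → ZMod p

/-- The complex vector space with basis the kets `|s⟩`, `s` a configuration.  Operators of finite
support act faithfully on it. -/
abbrev States (p q : ℕ) : Type := Config p q →₀ ℂ

/-- The group of invertible linear operators on `States p q`; multiplication is composition. -/
abbrev Op (p q : ℕ) : Type := States p q ≃ₗ[ℂ] States p q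

/-- The linear map `|s⟩ ↦ u s • |s⟩`. -/
def diagMap {p q : ℕ} (u : Config p q → ℂˣ) : States p q →ₗ[ℂ] States p q :=
  Finsupp.lsum ℂ fun s => (u s : ℂ) • Finsupp.lsingle s

theorem diagMap_single {p q : ℕ} (u : Config p q → ℂˣ) (s : Config p q) (c : ℂ) :
    diagMap u (Finsupp.single s c) = Finsupp.single s (u s * c) := by
  simp [diagMap]

/-- The diagonal operator `|s⟩ ↦ u s • |s⟩`. -/
def diagOp {p q : ℕ} (u : Config p q → ℂˣ) : Op p q :=
  LinearEquiv.ofLinearMap (diagMap u) (diagMap fun s => (u s)⁻¹)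
    (by ext s : 2; simp [diagMap_single])
    (by ext s : 2; simp [diagMap_single])

/-- The shift operator `X` on the qudit `i`: `|s⟩ ↦ |s + e_i⟩`, where `s i` is taken mod `p`. -/
def opX (p : ℕ) {q : ℕ} (i : ℤ × Fin q) : Op p q :=
  Finsupp.domLCongr (Equiv.addRight (Pi.single i (1 : ZMod p)))

/-- The clock operator `Z` on the qudit `i`: `|s⟩ ↦ exp (2π√-1 s_i / p) |s⟩`. -/
def opZ (p : ℕ) {q : ℕ} (i : ℤ × Fin q) : Op p q :=
  diagOp fun s => Units.mk0
    (Complex.exp (2 * Real.pi * Complex.I * ((s i).val : ℂ) / (p : ℂ))) (Complex.exp_ne_zero _)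

/-- Multiplication by the phase `c`. -/
def opPhase (p q : ℕ) (c : Circle) : Op p q :=
  LinearEquiv.smulOfUnit (Circle.toUnits c)

/-- Translation of the chain by `n` sites: what was at site `j` is moved to site `j + n`. -/
def opShift (p q : ℕ) (n : ℤ) : Op p q :=
  Finsupp.domLCongr
    (Equiv.arrowCongr ((Equiv.addRight n).prodCongr (Equiv.refl (Fin q))) (Equiv.refl (ZMod p)))

/-- The translate of the operator `U` by `n` sites. -/
def translate {p q : ℕ} (n : ℤ) (U : Op p q) : Op p q :=
  opShift p q n * U * (opShift p q n)⁻¹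

/-- A set of operators is invariant under the translations by all multiples of `b`. -/
def IsTranslationInvariant {p q : ℕ} (b : ℕ) (M : Set (Op p q)) : Prop :=
  ∀ n : ℤ, ∀ U ∈ M, translate ((b : ℤ) * n) U ∈ M

/-- The group of Pauli operators supported on the set `I` of sites: it is generated by the `X` and
`Z` of all qudits on sites in `I`, together with the phases in `Γ`.  (For `Γ = ⊥` this is the group
generated by `X`'s and `Z`'s only; for qubits one often takes `Γ = {1, -1, √-1, -√-1}`.) -/
def pauliOn (p q : ℕ) (Γ : Subgroup Circle) (I : Set ℤ) : Subgroup (Op p q) :=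
  Subgroup.closure
    ({U | ∃ c ∈ Γ, U = opPhase p q c} ∪
      {U | ∃ j ∈ I, ∃ k : Fin q, U = opX p (j, k) ∨ U = opZ p (j, k)})

/-- The Pauli group of the chain, with phases in `Γ`.  All its elements have finite support. -/
def pauliGroup (p q : ℕ) (Γ : Subgroup Circle) : Subgroup (Op p q) :=
  pauliOn p q Γ Set.univ

/-- A set of operators is local if all of them are Pauli operators supported on intervals of one
common length. -/
def IsLocalPauliSet {p q : ℕ} (Γ : Subgroup Circle) (M : Set (Op p q)) : Prop :=
  ∃ l : ℕ, ∀ U ∈ M, ∃ n : ℤ, U ∈ pauliOn p q Γ (Set.Icc n (n + l))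

end Operators

/-! ### Pauli modules over the translation group algebra -/

section Modules

/-- The Pauli module `R^{2q}` over `R = 𝔽_p[x, x⁻¹]`: upper half for `X`, lower half for `Z`. -/
abbrev PauliModule (p q : ℕ) : Type := Fin q ⊕ Fin q → (ZMod p)[T;T⁻¹]

/-- The matrix `λ_q`, with blocks `0, I, -I, 0`. -/
def lambdaMatrix (p q : ℕ) : Matrix (Fin q ⊕ Fin q) (Fin q ⊕ Fin q) (ZMod p)[T;T⁻¹] :=
  Matrix.fromBlocks 0 1 (-1) 0

/-- The anti-hermitian form `v† λ_q w`, where `†` is transposition followed by `x ↦ x⁻¹`. -/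
def antiHermitianForm {p q : ℕ} (v w : PauliModule p q) : (ZMod p)[T;T⁻¹] :=
  (fun i => LaurentPolynomial.invert (v i)) ⬝ᵥ (lambdaMatrix p q).mulVec w

/-- The scalar-valued symplectic form: the coefficient of `1 = x ^ 0` in `v† λ_q w`. -/
def scalarForm {p q : ℕ} (v w : PauliModule p q) : ZMod p :=
  (antiHermitianForm v w).coeff 0

/-- The orthogonal complement with respect to the scalar-valued symplectic form. -/
def perp {p q : ℕ} (M : Set (PauliModule p q)) : Set (PauliModule p q) :=
  {v | ∀ u ∈ M, scalarForm u v = 0}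

/-- The subring `R_b = 𝔽_p[x ^ b, x ^ (-b)]` of `R`: the group algebra of the translations by
multiples of `b`. -/
def coarseRing (p b : ℕ) : Subalgebra (ZMod p) (ZMod p)[T;T⁻¹] :=
  Algebra.adjoin (ZMod p) {LaurentPolynomial.T (b : ℤ), LaurentPolynomial.T (-(b : ℤ))}

end Modules

end PauliChain

end

/-! Up to scalars a Pauli operator is a vector of `R^{2q}`, and two of them commute exactly when
`scalarForm` vanishes on their vectors (`IsWeyl.commute_iff`). The vectors of a
translation-invariant `G` form an `R`-submodule `A`, so both parts ask for a Lagrangian of `B =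
A^⊥`, i.e. an `S ⊆ B` with `S^⊥ ∩ B = S`, invariant under some coarser translations. Freeness and
finite generation are then automatic, because the coarse ring is a PID.

Lift the form on `B` to an `R`-valued skew-hermitian form `herm`. A functional `Φ : B → R` that
kills the radical need not be some `herm u`; this obstruction is a local charge. The Gram
determinant of `B` modulo its radical is a nonzero `f` annihilating all charges
(`exists_ne_zero_mul_eq_herm`). Over a finite field `f` divides some `T ^ b - 1`
(`exists_dvd_T_sub_one`), so after grouping `b` sites into one every charge is killed by `T - 1`
(`exists_coarse_lagrangian`).

In that case a maximal isotropic `S` is Lagrangian (`exists_lagrangian`). Otherwise `S^⊥ / S` is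
free of rank `r > 0`, with a Gram matrix `H` dividing `T - 1`. Hence the exponents of `det H` spread
over at most `r`, and skew-hermiticity centres them at `0`, so its top degree is at most `r / 2 <
r`. A dimension count gives a nonzero polynomial vector `V` for which `H V` has no positive powers
(`exists_ne_zero_coeff_eq_zero`). Then `V† H V` has no positive powers, by skewness no negative
ones, and no constant term because the form is alternating. So `V` is a new isotropic vector,
contradicting maximality. -/

/-! ### Laurent polynomials, and short vectors in lattices over `k[X]` -/

open Polynomial in
theorem LaurentPolynomial.isPrincipalIdealRing (k : Type*) [Field k] :
    IsPrincipalIdealRing k[T;T⁻¹] := by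
  refine ⟨fun I => ?_⟩
  obtain ⟨f, hf⟩ := (IsPrincipalIdealRing.principal (I.under k[X]))
  refine ⟨algebraMap k[X] k[T;T⁻¹] f, ?_⟩
  rw [← IsLocalization.map_under (Submonoid.powers (X : k[X])) k[T;T⁻¹] I, hf,
    Ideal.submodule_span_eq, Ideal.map_span, Set.image_singleton, Ideal.submodule_span_eq]

instance {k : Type*} [Field k] : IsPrincipalIdealRing k[T;T⁻¹] :=
  LaurentPolynomial.isPrincipalIdealRing k

-- Up to a unit `f` is a polynomial `g`, and `k[X] / (g)` is finite, so two powers of `X` agree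
-- modulo `g`; the lower power is a unit in Laurent polynomials. This is where finiteness of the
-- field enters.
open Polynomial in
theorem LaurentPolynomial.exists_dvd_T_sub_one {k : Type*} [Field k] [Finite k] {f : k[T;T⁻¹]}
    (hf : f ≠ 0) : ∃ b : ℕ, 1 ≤ b ∧ f ∣ T (b : ℤ) - 1 := by
  obtain ⟨n, g, hg⟩ := f.exists_T_pow
  have hg0 : g ≠ 0 := by
    rintro rfl
    rw [map_zero, eq_comm, (isUnit_T _).mul_left_eq_zero] at hg
    exact hf hg
  have : Module.Finite k (AdjoinRoot g) := (AdjoinRoot.powerBasis hg0).finite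
  have : Finite (AdjoinRoot g) := Module.finite_of_finite k
  obtain ⟨i, j, hij, h⟩ := Finite.exists_ne_map_eq_of_infinite
    (fun n : ℕ => AdjoinRoot.mk g (X ^ n))
  wlog hlt : i < j generalizing i j
  · exact this j i hij.symm h.symm (by omega)
  refine ⟨j - i, by omega, ?_⟩
  obtain ⟨c, hc⟩ := AdjoinRoot.mk_eq_mk.1 h.symm
  have h1 : (T (j : ℤ) - T (i : ℤ) : k[T;T⁻¹]) = f * (T (n : ℤ) * toLaurent c) := by
    rw [← mul_assoc, ← hg, ← map_mul, ← hc]; simp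
  refine ⟨T (n : ℤ) * toLaurent c * T (-(i : ℤ)), ?_⟩
  rw [← mul_assoc, ← h1, sub_mul, ← T_add, ← T_add, Nat.cast_sub hlt.le]
  simp [sub_eq_add_neg]

open Polynomial in
/-- A lattice of small covolume contains a short vector. -/
theorem Matrix.exists_ne_zero_natDegree_mulVec_le {k ι : Type*} [Field k] [Fintype ι]
    [DecidableEq ι] (M : Matrix ι ι k[X]) (N : ℕ) (h0 : M.det ≠ 0)
    (hdeg : M.det.natDegree < Fintype.card ι * (N + 1)) :
    ∃ v : ι → k[X], v ≠ 0 ∧ ∀ i, (M.mulVec v i).natDegree ≤ N := by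
  classical
  have hinj : Function.Injective M.toLin' := by
    rw [← LinearMap.ker_eq_bot, LinearMap.ker_eq_bot']
    intro v hv
    exact Matrix.eq_zero_of_mulVec_eq_zero h0 (by simpa using hv)
  let P : Submodule k[X] (ι → k[X]) := LinearMap.range M.toLin'
  let e : (ι → k[X]) ≃ₗ[k[X]] P := LinearEquiv.ofInjective M.toLin' hinj
  let b := Pi.basisFun k[X] ι
  have hrank : Module.finrank k[X] P = Module.finrank k[X] (ι → k[X]) := e.finrank_eq.symm
  let a := Submodule.smithNormalFormCoeffs b hrank
  let b' := Submodule.smithNormalFormTopBasis b hrank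
  let ab := Submodule.smithNormalFormBotBasis b hrank
  have ab_eq := Submodule.smithNormalFormBotBasis_def b hrank
  have ha0 : ∀ i, a i ≠ 0 := Submodule.smithNormalFormCoeffs_ne_zero b hrank
  -- Smith normal form writes `M` as a diagonal matrix up to changes of basis in source and target,
  -- which alter the determinant only by units.
  have hassoc : Associated M.det (∏ i, a i) := by
    rw [← Matrix.det_diagonal, ← LinearMap.det_toLin', ← LinearMap.det_toLin b']
    let e' : (ι → k[X]) ≃ₗ[k[X]] (ι → k[X]) := (b'.equiv ab (Equiv.refl _)).trans e.symm
    refine (LinearMap.associated_det_of_eq_comp e' _ _ fun x => ?_).symm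
    have : Matrix.toLin b' b' (Matrix.diagonal a) = M.toLin' ∘ₗ e'.toLinearMap := by
      refine b'.ext fun i => ?_
      have h1 : M.toLin' (e' (b' i)) = (ab i : ι → k[X]) := by
        have : ((e (e.symm (ab i)) : P) : ι → k[X]) = M.toLin' (e.symm (ab i)) := rfl
        simp only [e', LinearEquiv.trans_apply, Module.Basis.equiv_apply, Equiv.refl_apply]
        rw [← this, LinearEquiv.apply_symm_apply]
      rw [LinearMap.comp_apply, LinearEquiv.coe_coe, h1, ab_eq, Matrix.toLin_self]
      simp [Matrix.diagonal_apply, b', a]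
    rw [this]; rfl
  have hfin : ∀ i, Module.Finite k (k[X] ⧸ Ideal.span ({a i} : Set k[X])) := fun i =>
    (AdjoinRoot.powerBasis (ha0 i)).finite
  have hdim : Module.finrank k ((ι → k[X]) ⧸ P) = M.det.natDegree := by
    rw [Submodule.finrank_quotient_eq_sum k b hrank,
      natDegree_eq_of_degree_eq (degree_eq_degree_of_associated hassoc),
      natDegree_prod _ _ fun i _ => ha0 i]
    exact Finset.sum_congr rfl fun i _ => (AdjoinRoot.powerBasis (ha0 i)).finrank
  have : Module.Finite k ((ι → k[X]) ⧸ P) :=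
    Module.Finite.equiv ((P.quotientEquivPiSpan b hrank).restrictScalars k).symm
  let F : (ι → degreeLT k (N + 1)) →ₗ[k] ((ι → k[X]) ⧸ P) :=
    (P.mkQ.restrictScalars k) ∘ₗ
      LinearMap.pi fun i => (degreeLT k (N + 1)).subtype ∘ₗ LinearMap.proj i
  have : Module.Finite k (degreeLT k (N + 1)) :=
    Module.Finite.equiv (degreeLTEquiv k (N + 1)).symm
  -- Vectors with entries of degree at most `N` form a space of dimension `card ι * (N + 1)`, larger
  -- than the codimension `deg det M` of the lattice `P`, so a nonzero one lies in `P`.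
  have hker : LinearMap.ker F ≠ ⊥ := by
    apply LinearMap.ker_ne_bot_of_finrank_lt
    rw [hdim, Module.finrank_pi_fintype]
    simpa [(degreeLTEquiv k (N + 1)).finrank_eq] using hdeg
  obtain ⟨w, hw, hw0⟩ := Submodule.exists_mem_ne_zero_of_ne_bot hker
  have hwP : (fun i => (w i : k[X])) ∈ P := (Submodule.Quotient.mk_eq_zero P).1 hw
  obtain ⟨v, hv⟩ := hwP
  rw [Matrix.toLin'_apply] at hv
  refine ⟨v, ?_, fun i => ?_⟩
  · rintro rfl
    apply hw0
    ext1 i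
    have := congrFun hv i
    simp only [Matrix.mulVec_zero, Pi.zero_apply] at this
    exact Subtype.ext this.symm
  · rw [hv]
    have := mem_degreeLT.1 (w i).2
    exact Nat.lt_succ_iff.1 (by
      by_cases h : (w i : k[X]) = 0
      · simp [h]
      · exact (natDegree_lt_iff_degree_lt h).2 this)

open Polynomial in
theorem LaurentPolynomial.exists_matrix_toLaurent {k ι : Type*} [Field k] [Fintype ι]
    (H : Matrix ι ι k[T;T⁻¹]) :
    ∃ (n : ℕ) (M : Matrix ι ι k[X]), M.map toLaurent = (T (n : ℤ) : k[T;T⁻¹]) • H := by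
  choose n g hg using fun ij : ι × ι => (H ij.1 ij.2).exists_T_pow
  refine ⟨∑ ij, n ij, Matrix.of fun i j => g (i, j) * X ^ (∑ ij, n ij - n (i, j)), ?_⟩
  ext1 i j
  have hle : n (i, j) ≤ ∑ ij, n ij :=
    Finset.single_le_sum (f := n) (fun _ _ => Nat.zero_le _) (Finset.mem_univ _)
  simp only [Matrix.map_apply, Matrix.of_apply, map_mul, hg, toLaurent_X_pow,
    Matrix.smul_apply, smul_eq_mul]
  rw [mul_assoc, ← T_add, mul_comm]
  congr 2
  push_cast [Nat.cast_sub hle]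
  ring

open Polynomial in
/-- The determinant of a skew-hermitian matrix has as much room above as below degree zero. -/
theorem LaurentPolynomial.natDegree_add_natTrailingDegree_det {k ι : Type*} [Field k] [Fintype ι]
    [DecidableEq ι] {H : Matrix ι ι k[T;T⁻¹]} (hH : ∀ i j, invert (H i j) = -H j i) {n : ℕ}
    {M : Matrix ι ι k[X]} (hM : M.map toLaurent = (T (n : ℤ) : k[T;T⁻¹]) • H) (h0 : M.det ≠ 0) :
    M.det.natDegree + M.det.natTrailingDegree = 2 * (Fintype.card ι * n) := by
  set r := Fintype.card ι
  have hdet : toLaurent M.det = T ((r * n : ℕ) : ℤ) * H.det := by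
    rw [RingHom.map_det, RingHom.mapMatrix_apply, hM, Matrix.det_smul, T_pow]
    push_cast; rfl
  have hinv : invert H.det = (-1) ^ r * H.det := by
    have : (invert : k[T;T⁻¹] ≃ₐ[k] _).toRingEquiv.toRingHom.mapMatrix H = -H.transpose := by
      ext1 i j; exact hH i j
    calc invert H.det = (invert : k[T;T⁻¹] ≃ₐ[k] _).toRingEquiv.toRingHom H.det := rfl
      _ = _ := by rw [RingHom.map_det, this, Matrix.det_neg, Matrix.det_transpose]
  -- Reversal is `T ↦ T⁻¹` up to a shift, and `det H` changes only by the sign `(-1) ^ r` under it.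
  -- Comparing degrees, with the reverse of degree `natDegree - natTrailingDegree`, gives the claim.
  have hrev : toLaurent (M.det.reverse * X ^ (2 * (r * n))) =
      toLaurent (Polynomial.C ((-1) ^ r) * M.det * X ^ M.det.natDegree) := by
    rw [map_mul, toLaurent_reverse, hdet, map_mul, hinv, map_mul, map_mul, hdet, toLaurent_X_pow,
      toLaurent_X_pow, invert_T, toLaurent_C]
    have : (T ((2 * (r * n) : ℕ) : ℤ) : k[T;T⁻¹]) = T ((r * n : ℕ) : ℤ) * T ((r * n : ℕ) : ℤ) := by
      rw [← T_add]; congr 1; push_cast; ring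
    have h1 : (T (-((r * n : ℕ) : ℤ)) * T ((r * n : ℕ) : ℤ) : k[T;T⁻¹]) = 1 := by
      rw [← T_add]; simp
    rw [this]
    simp only [map_pow, map_neg, map_one]
    linear_combination ((-1) ^ r * H.det * T (M.det.natDegree : ℤ) * T ((r * n : ℕ) : ℤ)) * h1
  have hpoly := toLaurent_injective hrev
  have hdeg := congrArg natDegree hpoly
  have hC : (Polynomial.C ((-1) ^ r) : k[X]) ≠ 0 := by simp
  rw [natDegree_mul (by simpa using h0) (by simp), natDegree_mul (mul_ne_zero hC h0) (by simp),
    natDegree_mul hC h0, natDegree_C, reverse_natDegree, natDegree_X_pow, natDegree_X_pow] at hdeg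
  have := natTrailingDegree_le_natDegree M.det
  omega

open Polynomial in
/-- A skew-hermitian matrix over Laurent polynomials whose discriminant module is killed by `T - 1`
admits a nonzero vector with no positive powers in its value. -/
theorem LaurentPolynomial.exists_ne_zero_coeff_eq_zero {k ι : Type*} [Field k] [Fintype ι]
    [DecidableEq ι] [Nonempty ι] {H H' : Matrix ι ι k[T;T⁻¹]}
    (hH : ∀ i j, invert (H i j) = -H j i) (hH' : H' * H = (T 1 - 1 : k[T;T⁻¹]) • 1) :
    ∃ V : ι → k[T;T⁻¹], V ≠ 0 ∧
      ∀ n : ℤ, 0 < n → (∑ i, invert (V i) * (H.mulVec V) i).coeff n = 0 := by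
  obtain ⟨n, M, hM⟩ := exists_matrix_toLaurent H
  obtain ⟨n', M', hM'⟩ := exists_matrix_toLaurent H'
  set r := Fintype.card ι
  have hr : 0 < r := Fintype.card_pos
  have hX1 : (X - 1 : k[X]) ≠ 0 := by simpa using X_sub_C_ne_zero (1 : k)
  have hprod : M'.det * M.det = (X ^ (n' + n) * (X - 1)) ^ r := by
    rw [← Matrix.det_mul]
    have : M' * M = (X ^ (n' + n) * (X - 1) : k[X]) • 1 := by
      apply Matrix.map_injective toLaurent_injective
      change (M' * M).map toLaurent =
        ((X ^ (n' + n) * (X - 1) : k[X]) • 1 : Matrix ι ι k[X]).map toLaurent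
      rw [Matrix.map_mul, hM, hM', Matrix.smul_mul, Matrix.mul_smul, hH', smul_smul, smul_smul,
        Matrix.map_smul' _ _ _ (map_mul _), map_mul, map_sub, toLaurent_X_pow, toLaurent_X, map_one,
        Nat.cast_add, T_add]
      congr 1
      rw [Matrix.map_one _ (map_zero _) (map_one _)]
    rw [this, Matrix.det_smul, Matrix.det_one, mul_one]
  have hne : M'.det * M.det ≠ 0 := by
    rw [hprod]; exact pow_ne_zero _ (mul_ne_zero (by simp) hX1)
  have h0 : M.det ≠ 0 := right_ne_zero_of_mul hne
  have h0' : M'.det ≠ 0 := left_ne_zero_of_mul hne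
  have hsum := natDegree_add_natTrailingDegree_det hH hM h0
  have hd := congrArg natDegree hprod
  have ht := congrArg natTrailingDegree hprod
  have hX1d : (X - 1 : k[X]).natDegree = 1 := by simpa using natDegree_X_sub_C (1 : k)
  have hX1t : ((X - 1 : k[X]) ^ r).natTrailingDegree = 0 :=
    natTrailingDegree_eq_zero.2 (Or.inr (by simp [coeff_zero_eq_eval_zero]))
  rw [natDegree_mul h0' h0, natDegree_pow, natDegree_mul (by simp) hX1, natDegree_X_pow,
    hX1d] at hd
  rw [natTrailingDegree_mul h0' h0, mul_pow, ← pow_mul, mul_comm (X ^ _),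
    natTrailingDegree_mul_X_pow (pow_ne_zero _ hX1), hX1t, zero_add] at ht
  have h1 := natTrailingDegree_le_natDegree M.det
  have h2 := natTrailingDegree_le_natDegree M'.det
  -- From `hd` and `ht` the spread of `det M` is at most `r`; with `hsum` its degree is at most `r *
  -- n + r / 2`, which is below `r * (n + 1)` because `r > 0`.
  obtain ⟨v, hv0, hv⟩ := M.exists_ne_zero_natDegree_mulVec_le n h0 (by
    change _ < r * (n + 1)
    have h3 : r * (n' + n + 1) = (n' + n) * r + r := by ring
    have h4 : r * (n + 1) = r * n + r := by ring
    rw [h4]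
    rw [h3] at hd
    change _ = 2 * (r * n) at hsum
    omega)
  refine ⟨fun i => toLaurent (v i), ?_, fun m hm => ?_⟩
  · contrapose! hv0
    ext1 i
    exact toLaurent_eq_zero.1 (congrFun hv0 i)
  · have hHv : ∀ i, (T (n : ℤ) : k[T;T⁻¹]) * (H.mulVec fun i => toLaurent (v i)) i =
        toLaurent (M.mulVec v i) := by
      intro i
      rw [RingHom.map_mulVec, hM, Matrix.smul_mulVec]
      rfl
    rw [AddMonoidAlgebra.coeff_sum, Finsupp.finsetSum_apply]
    refine Finset.sum_eq_zero fun i _ => ?_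
    -- Each summand is the inversion of an honest polynomial, since `M v` has degree at most `n`;
    -- hence it has no positive powers.
    have hcalc : invert (toLaurent (v i)) * (H.mulVec fun i => toLaurent (v i)) i =
        invert (toLaurent (v i) * invert (toLaurent (M.mulVec v i)) * T (n : ℤ)) := by
      rw [← hHv, map_mul, map_mul, invert_T, map_mul, map_mul, invert_T, invert_T]
      rw [involutive_invert]
      have : (T (- -(n : ℤ)) * T (-(n : ℤ)) : k[T;T⁻¹]) = 1 := by rw [← T_add]; simp
      linear_combination
        (-(invert (toLaurent (v i)) * (H.mulVec fun i => toLaurent (v i)) i)) * this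
    have hrev : invert (toLaurent (M.mulVec v i)) * T (n : ℤ) =
        toLaurent ((M.mulVec v i).reverse * X ^ (n - (M.mulVec v i).natDegree)) := by
      rw [map_mul, toLaurent_reverse, toLaurent_X_pow, mul_assoc, ← T_add, Nat.cast_sub (hv i)]
      congr 2; ring
    rw [hcalc, mul_assoc, hrev, ← map_mul, invert_apply, coeff_toLaurent]
    exact Finsupp.mapDomain_of_notMem_range _ _ (by rintro ⟨a, ha⟩; simp at ha; omega)

/-! ### Functionals over `k` versus homomorphisms over Laurent polynomials -/

namespace LaurentPolynomial

variable {k N : Type*} [Field k] [AddCommGroup N] [Module k N] [Module k[T;T⁻¹] N]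
  [IsScalarTower k k[T;T⁻¹] N]

/-- A linear map over the ground field that commutes with monomials is linear over Laurent
polynomials. -/
theorem map_smul_of_map_T_smul {M : Type*} [AddCommGroup M] [Module k M] [Module k[T;T⁻¹] M]
    [IsScalarTower k k[T;T⁻¹] M] (f : N →ₗ[k] M)
    (hf : ∀ (n : ℤ) v, f ((T n : k[T;T⁻¹]) • v) = (T n : k[T;T⁻¹]) • f v)
    (a : k[T;T⁻¹]) (v : N) : f (a • v) = a • f v := by
  induction a using LaurentPolynomial.induction_on' with
  | add p q hp hq => rw [add_smul, add_smul, map_add, hp, hq]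
  | C_mul_T n c =>
    rw [← smul_eq_C_mul, smul_assoc, smul_assoc, map_smul, hf]

theorem coeff_T_mul {R : Type*} [Semiring R] (m n : ℤ) (f : R[T;T⁻¹]) :
    (T m * f).coeff n = f.coeff (n - m) := by
  rw [T_mul, T, AddMonoidAlgebra.coeff_mul_single_apply, mul_one]; rfl

/-- The homomorphism whose constant coefficient is a given functional. -/
noncomputable def homOfFunctional (l : N →ₗ[k] k)
    (hl : ∀ v, {n : ℤ | l ((T n : k[T;T⁻¹]) • v) ≠ 0}.Finite) : N →ₗ[k[T;T⁻¹]] k[T;T⁻¹] :=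
  let f : N →ₗ[k] k[T;T⁻¹] :=
    { toFun v := .ofCoeff (Finsupp.ofSupportFinite (fun n => l ((T (-n) : k[T;T⁻¹]) • v))
        (by simpa using! (hl v).preimage (neg_injective (G := ℤ)).injOn))
      map_add' u v := by
        ext n; change l _ = l _ + l _; rw [smul_add, map_add]
      map_smul' c v := by
        ext n; change l _ = c • l _; rw [smul_comm, map_smul] }
  { f with
    map_smul' a v := by
      refine map_smul_of_map_T_smul f (fun m v => ?_) a v
      ext n
      rw [smul_eq_mul, coeff_T_mul]
      change l _ = l _
      rw [smul_smul, ← T_add]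
      congr 3; ring }

@[simp]
theorem coeff_homOfFunctional (l : N →ₗ[k] k)
    (hl : ∀ v, {n : ℤ | l ((T n : k[T;T⁻¹]) • v) ≠ 0}.Finite) (v : N) (n : ℤ) :
    (homOfFunctional l hl v).coeff n = l ((T (-n) : k[T;T⁻¹]) • v) :=
  rfl

theorem coeff_hom {M : Type*} [AddCommGroup M] [Module k[T;T⁻¹] M]
    (Φ : M →ₗ[k[T;T⁻¹]] k[T;T⁻¹]) (v : M) (n : ℤ) :
    (Φ v).coeff n = (Φ ((T (-n) : k[T;T⁻¹]) • v)).coeff 0 := by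
  rw [map_smul, smul_eq_mul, coeff_T_mul]; simp

end LaurentPolynomial

/-! ### Translation-invariant alternating forms and Lagrangian submodules -/

open LaurentPolynomial

/-- An alternating, translation-invariant form of finite range. -/
structure ChainForm (k N : Type*) [Field k] [AddCommGroup N] [Module k N]
    [Module k[T;T⁻¹] N] where
  form : N →ₗ[k] N →ₗ[k] k
  form_self : ∀ u, form u u = 0
  form_T_smul : ∀ (n : ℤ) u v, form ((T n : k[T;T⁻¹]) • u) ((T n : k[T;T⁻¹]) • v) = form u v
  finite_range : ∀ u v, {n : ℤ | form u ((T n : k[T;T⁻¹]) • v) ≠ 0}.Finite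

namespace ChainForm

variable {k N : Type*} [Field k] [AddCommGroup N] [Module k N] [Module k[T;T⁻¹] N]
  (ω : ChainForm k N)

theorem form_swap (u v : N) : ω.form u v = -ω.form v u := by
  have h := ω.form_self (u + v)
  simp only [map_add, LinearMap.add_apply, ω.form_self, zero_add, add_zero] at h
  exact eq_neg_of_add_eq_zero_right h

variable [IsScalarTower k k[T;T⁻¹] N]

/-- The Laurent-polynomial valued form with constant coefficient `ω.form`. -/
noncomputable def herm (u : N) : N →ₗ[k[T;T⁻¹]] k[T;T⁻¹] :=
  homOfFunctional (ω.form u) (ω.finite_range u)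

theorem coeff_herm (u v : N) (n : ℤ) :
    (ω.herm u v).coeff n = ω.form u ((T (-n) : k[T;T⁻¹]) • v) := rfl

theorem coeff_zero_herm (u v : N) : (ω.herm u v).coeff 0 = ω.form u v := by
  rw [coeff_herm, neg_zero, T_zero, one_smul]

theorem invert_herm (u v : N) : invert (ω.herm u v) = -ω.herm v u := by
  ext n
  rw [invert_apply, coeff_herm, AddMonoidAlgebra.coeff_neg, Finsupp.neg_apply, coeff_herm,
    ω.form_swap, ← ω.form_T_smul n v, smul_smul, ← T_add]
  simp

theorem herm_swap (u v : N) : ω.herm u v = -invert (ω.herm v u) := by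
  rw [invert_herm, neg_neg]

theorem herm_add_left (u u' v : N) : ω.herm (u + u') v = ω.herm u v + ω.herm u' v := by
  rw [herm_swap, map_add, map_add, neg_add, ← herm_swap, ← herm_swap]

theorem herm_smul_left (a : k[T;T⁻¹]) (u v : N) :
    ω.herm (a • u) v = invert a * ω.herm u v := by
  rw [herm_swap, map_smul, smul_eq_mul, map_mul, ← mul_neg, ← herm_swap]

theorem herm_sum_left {ι : Type*} (s : Finset ι) (f : ι → N) (v : N) :
    ω.herm (∑ i ∈ s, f i) v = ∑ i ∈ s, ω.herm (f i) v := by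
  rw [herm_swap, map_sum, map_sum, ← Finset.sum_neg_distrib]
  exact Finset.sum_congr rfl fun i _ => (ω.herm_swap _ _).symm

/-- If the value of `herm` at a vector has no positive powers, the vector is isotropic. -/
theorem herm_self_eq_zero {w : N} (h : ∀ n : ℤ, 0 < n → (ω.herm w w).coeff n = 0) :
    ω.herm w w = 0 := by
  ext n
  rcases lt_trichotomy n 0 with hn | rfl | hn
  · have h1 := h (-n) (by omega)
    rw [herm_swap, AddMonoidAlgebra.coeff_neg, Finsupp.neg_apply, invert_apply, neg_neg,
      neg_eq_zero] at h1
    exact h1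
  -- The constant term needs the alternating property: in characteristic two, skewness alone would
  -- not kill it.
  · rw [coeff_zero_herm, form_self]; rfl
  · exact h n hn

/-- The orthogonal complement of a submodule. -/
def perp (S : Submodule k[T;T⁻¹] N) : Submodule k[T;T⁻¹] N where
  carrier := {v | ∀ u ∈ S, ω.herm u v = 0}
  add_mem' h1 h2 u hu := by rw [map_add, h1 u hu, h2 u hu, add_zero]
  zero_mem' u _ := map_zero _
  smul_mem' a v hv u hu := by rw [map_smul, hv u hu, smul_zero]

theorem mem_perp {S : Submodule k[T;T⁻¹] N} {v : N} :
    v ∈ ω.perp S ↔ ∀ u ∈ S, ω.herm u v = 0 := Iff.rfl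

/-- Every coefficient of `herm u v` is the scalar form of a translate of `u` with `v`, and `S`
contains these translates. -/
theorem mem_perp_iff_form {S : Submodule k[T;T⁻¹] N} {v : N} :
    v ∈ ω.perp S ↔ ∀ u ∈ S, ω.form u v = 0 := by
  refine ⟨fun h u hu => ?_, fun h u hu => ?_⟩
  · rw [← coeff_zero_herm, h u hu]; rfl
  · ext n
    rw [coeff_herm, ← ω.form_T_smul n, smul_smul, ← T_add, add_neg_cancel, T_zero, one_smul]
    exact h _ (S.smul_mem _ hu)

theorem herm_eq_zero_comm {u v : N} : ω.herm u v = 0 ↔ ω.herm v u = 0 := by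
  rw [herm_swap, neg_eq_zero, map_eq_zero_iff _ (invert (R := k)).injective]

theorem perp_saturated (S : Submodule k[T;T⁻¹] N) {a : k[T;T⁻¹]} {v : N} (ha : a ≠ 0)
    (h : a • v ∈ ω.perp S) : v ∈ ω.perp S := by
  intro u hu
  have := h u hu
  rw [map_smul, smul_eq_mul, mul_eq_zero] at this
  exact this.resolve_left ha

variable [Module.Finite k[T;T⁻¹] N]

/-- Lifts of a basis of `D ⧸ S`, where `S ≤ D` is saturated. -/
theorem exists_basis_lift {M : Type*} [AddCommGroup M] [Module k[T;T⁻¹] M]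
    [Module.Finite k[T;T⁻¹] M] {S D : Submodule k[T;T⁻¹] M}
    (hsat : ∀ (a : k[T;T⁻¹]) (v : M), v ∈ D → a ≠ 0 → a • v ∈ S → v ∈ S) :
    ∃ (r : ℕ) (e : Fin r → M) (φ : Fin r → D →ₗ[k[T;T⁻¹]] k[T;T⁻¹]),
      (∀ i, e i ∈ D) ∧ (∀ j (v : D), (v : M) ∈ S → φ j v = 0) ∧
      (∀ i j (hi : e i ∈ D), φ j ⟨e i, hi⟩ = if i = j then 1 else 0) ∧
      (∀ v : D, (v : M) - ∑ i, φ i v • e i ∈ S) := by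
  let Q := D ⧸ S.comap D.subtype
  have : Module.IsTorsionFree k[T;T⁻¹] Q := by
    refine Module.IsTorsionFree.of_smul_eq_zero fun a q h => ?_
    induction q using Submodule.Quotient.induction_on with
    | H v =>
      rw [← Submodule.Quotient.mk_smul, Submodule.Quotient.mk_eq_zero] at h
      by_cases ha : a = 0
      · exact Or.inl ha
      · exact Or.inr ((Submodule.Quotient.mk_eq_zero _).2 (hsat a v v.2 ha h))
  obtain ⟨r, b⟩ := Module.basisOfFiniteTypeTorsionFree' (R := k[T;T⁻¹]) (M := Q)
  choose e he using fun i => Submodule.Quotient.mk_surjective _ (b i)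
  refine ⟨r, fun i => e i, fun j => b.coord j ∘ₗ Submodule.mkQ _, fun i => (e i).2,
    fun j v hv => ?_, fun i j hi => ?_, fun v => ?_⟩
  · have : Submodule.Quotient.mk (p := S.comap D.subtype) v = 0 :=
      (Submodule.Quotient.mk_eq_zero _).2 hv
    rw [LinearMap.comp_apply, Submodule.mkQ_apply, this, map_zero]
  · change b.coord j (Submodule.Quotient.mk (e i)) = _
    rw [he]
    simp [Finsupp.single_apply]
  · have : Submodule.Quotient.mk (p := S.comap D.subtype)
        (v - ∑ i, b.coord i (Submodule.Quotient.mk v) • e i) = 0 := by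
      rw [Submodule.Quotient.mk_sub, ← Submodule.mkQ_apply, ← Submodule.mkQ_apply, map_sum]
      simp only [map_smul, Submodule.mkQ_apply, he]
      simp [b.sum_repr]
    have := (Submodule.Quotient.mk_eq_zero _).1 this
    have h : (v : M) - ∑ i, b.coord i (Submodule.Quotient.mk v) • (e i : M) ∈ S := by
      simpa using this
    exact h

/-- Homomorphisms into the ring extend from orthogonal complements to the whole module. -/
theorem exists_extend_perp (S : Submodule k[T;T⁻¹] N) (φ : ω.perp S →ₗ[k[T;T⁻¹]] k[T;T⁻¹]) :
    ∃ Φ : N →ₗ[k[T;T⁻¹]] k[T;T⁻¹], ∀ v : ω.perp S, Φ v = φ v := by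
  -- Orthogonal complements are saturated, so this quotient is finite and torsion-free over a PID,
  -- hence projective, and the complement splits off.
  have : Module.IsTorsionFree k[T;T⁻¹] (N ⧸ ω.perp S) := by
    refine Module.IsTorsionFree.of_smul_eq_zero fun a q h => ?_
    induction q using Submodule.Quotient.induction_on with
    | H v =>
      rw [← Submodule.Quotient.mk_smul, Submodule.Quotient.mk_eq_zero] at h
      by_cases ha : a = 0
      · exact Or.inl ha
      · exact Or.inr ((Submodule.Quotient.mk_eq_zero _).2 (ω.perp_saturated S ha h))
  obtain ⟨s, hs⟩ := Module.projective_lifting_property (ω.perp S).mkQ LinearMap.id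
    (Submodule.mkQ_surjective _)
  have hs' : ∀ q, (ω.perp S).mkQ (s q) = q := fun q => LinearMap.congr_fun hs q
  refine ⟨φ ∘ₗ (LinearMap.id - s ∘ₗ (ω.perp S).mkQ).codRestrict (ω.perp S) fun v => ?_,
    fun v => ?_⟩
  · rw [LinearMap.comp_apply]
    congr 1
    have h0 : (ω.perp S).mkQ v = 0 := (Submodule.Quotient.mk_eq_zero _).2 v.2
    ext
    simp only [LinearMap.codRestrict_apply, LinearMap.sub_apply, LinearMap.comp_apply, h0,
      map_zero, LinearMap.id_apply, sub_zero]
  · rw [← Submodule.Quotient.mk_eq_zero, ← Submodule.mkQ_apply, LinearMap.sub_apply, map_sub,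
      LinearMap.comp_apply, hs', LinearMap.id_apply, sub_self]

/-- A finitely generated chain all of whose local charges are fixed by translations has a
Lagrangian submodule. -/
theorem exists_lagrangian
    (hω : ∀ Φ : N →ₗ[k[T;T⁻¹]] k[T;T⁻¹], (∀ v ∈ ω.perp ⊤, Φ v = 0) →
      ∃ u, ∀ v, (T 1 - 1) * Φ v = ω.herm u v) :
    ∃ S : Submodule k[T;T⁻¹] N, ω.perp S = S := by
  obtain ⟨S, hS, hmax⟩ := set_has_maximal_iff_noetherian.2
    (inferInstance : IsNoetherian k[T;T⁻¹] N) {S | S ≤ ω.perp S}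
    ⟨⊥, fun v hv u hu => by rw [(Submodule.mem_bot _).1 hv, map_zero]⟩
  have hS : S ≤ ω.perp S := hS
  -- Adjoining such a `w` to `S` keeps it isotropic, so maximality applies.
  have hiso : ∀ w ∈ ω.perp S, ω.herm w w = 0 → w ∈ S := by
    intro w hw hww
    by_contra hwS
    refine hmax (S ⊔ Submodule.span _ {w}) ?_ ?_
    · intro v hv u hu
      obtain ⟨s, hs, x, hx, rfl⟩ := Submodule.mem_sup.1 hv
      obtain ⟨s', hs', x', hx', rfl⟩ := Submodule.mem_sup.1 hu
      obtain ⟨a, rfl⟩ := Submodule.mem_span_singleton.1 hx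
      obtain ⟨a', rfl⟩ := Submodule.mem_span_singleton.1 hx'
      rw [map_add, herm_add_left, herm_add_left, map_smul, map_smul, herm_smul_left,
        herm_smul_left, hww, hw s' hs', hS hs s' hs', ω.herm_eq_zero_comm.1 (hw s hs)]
      simp
    · refine lt_of_le_of_ne le_sup_left fun h => hwS ?_
      rw [h]
      exact Submodule.mem_sup_right (Submodule.mem_span_singleton_self w)
  refine ⟨S, le_antisymm ?_ hS⟩
  obtain ⟨r, e, φ, he, hφS, hφe, hsum⟩ := exists_basis_lift (S := S) (D := ω.perp S) (by
    intro a v hv ha hav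
    refine hiso v hv ?_
    have h1 : ω.herm (a • v) (a • v) = 0 := hS hav _ hav
    rw [map_smul, herm_smul_left, smul_eq_mul, mul_eq_zero, mul_eq_zero,
      map_eq_zero_iff _ (invert (R := k)).injective] at h1
    tauto)
  choose Φ hΦ using fun j => ω.exists_extend_perp S (φ j)
  -- The radical lies in `S` by `hiso`, so the extended coordinate functionals vanish on it and `T -
  -- 1` times each of them is represented by a vector `x j`.
  choose x hx using fun j => hω (Φ j) (fun v hv => by
    have hvS : v ∈ ω.perp S := fun u _ => hv u trivial
    rw [hΦ j ⟨v, hvS⟩]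
    exact hφS j _ (hiso v hvS (hv v trivial)))
  have hxD : ∀ j, x j ∈ ω.perp S := by
    intro j s hs
    rw [herm_eq_zero_comm, ← hx, hΦ j ⟨s, hS hs⟩, hφS j _ hs, mul_zero]
  by_contra hne
  have hr : Nonempty (Fin r) := by
    by_contra hr
    have := not_nonempty_iff.1 hr
    exact hne fun v hv => by simpa using hsum ⟨v, hv⟩
  let H : Matrix (Fin r) (Fin r) k[T;T⁻¹] := .of fun i j => ω.herm (e i) (e j)
  -- Row `j` holds the inverted coordinates of `x j`; pairing `x j` with `e l` gives `T - 1` if `j =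
  -- l` and `0` otherwise, which is `H' * H = (T - 1) • 1`.
  let H' : Matrix (Fin r) (Fin r) k[T;T⁻¹] := .of fun j i => invert (φ i ⟨x j, hxD j⟩)
  have hSe : ∀ s ∈ S, ∀ j, ω.herm s (e j) = 0 := fun s hs j => he j s hs
  obtain ⟨V, hV0, hV⟩ := exists_ne_zero_coeff_eq_zero (H := H) (H' := H')
    (fun i j => ω.invert_herm _ _) (by
      ext1 j l
      have h1 := hSe _ (hsum ⟨x j, hxD j⟩) l
      rw [sub_eq_add_neg, herm_add_left, ← neg_one_smul k[T;T⁻¹], herm_smul_left, map_neg,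
        map_one, neg_one_mul, ← sub_eq_add_neg, sub_eq_zero, ← hx, hΦ j ⟨e l, he l⟩, hφe,
        herm_sum_left] at h1
      simp only [herm_smul_left] at h1
      rw [Matrix.mul_apply, Matrix.smul_apply, Matrix.one_apply, smul_eq_mul]
      simp only [H, H', Matrix.of_apply, ← h1, eq_comm])
  let w : N := ∑ i, V i • e i
  have hwD : w ∈ ω.perp S := Submodule.sum_mem _ fun i _ => Submodule.smul_mem _ _ (he i)
  have hww : ω.herm w w = ∑ i, invert (V i) * (H.mulVec V) i := by
    simp only [w, herm_sum_left, herm_smul_left, map_sum, map_smul, smul_eq_mul, Matrix.mulVec,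
      dotProduct, H, Matrix.of_apply, Finset.mul_sum]
    rw [Finset.sum_comm]
    exact Finset.sum_congr rfl fun i _ => Finset.sum_congr rfl fun j _ => by ring
  have hwS : w ∈ S := hiso w hwD (ω.herm_self_eq_zero fun n hn => by rw [hww]; exact hV n hn)
  apply hV0
  ext1 j
  have h2 := hφS j ⟨w, hwD⟩ hwS
  have : (⟨w, hwD⟩ : ω.perp S) = ∑ i, V i • ⟨e i, he i⟩ := by ext; simp [w]
  rw [this, map_sum] at h2
  simp only [map_smul, hφe, smul_eq_mul] at h2
  simpa using h2

/-- Some nonzero Laurent polynomial kills all local charges. -/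
theorem exists_ne_zero_mul_eq_herm :
    ∃ f : k[T;T⁻¹], f ≠ 0 ∧ ∀ Φ : N →ₗ[k[T;T⁻¹]] k[T;T⁻¹], (∀ v ∈ ω.perp ⊤, Φ v = 0) →
      ∃ u, ∀ v, f * Φ v = ω.herm u v := by
  obtain ⟨r, e, φ, -, hφS, hφe, hsum⟩ := exists_basis_lift (S := ω.perp ⊤) (D := ⊤)
    (fun a v _ ha hav => ω.perp_saturated ⊤ ha hav)
  let H : Matrix (Fin r) (Fin r) k[T;T⁻¹] := .of fun i j => ω.herm (e i) (e j)
  have key : ∀ Φ : N →ₗ[k[T;T⁻¹]] k[T;T⁻¹], (∀ v ∈ ω.perp ⊤, Φ v = 0) → (∀ i, Φ (e i) = 0) →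
      Φ = 0 := by
    intro Φ h0 he
    ext1 v
    have := h0 _ (hsum ⟨v, trivial⟩)
    rw [map_sub, map_sum] at this
    simpa [he] using this
  have hrad : ∀ u, ∀ v ∈ ω.perp ⊤, ω.herm u v = 0 := fun u v hv => hv u trivial
  -- A kernel vector of the Gram matrix would give a combination of the `e i` lying in the radical,
  -- where all the coordinates vanish.
  have hdet : H.det ≠ 0 := by
    intro h
    obtain ⟨V, hV0, hV⟩ := Matrix.exists_mulVec_eq_zero_iff.2 h
    apply hV0
    let w : N := ∑ i, V i • e i
    have hw : ω.herm w = 0 := by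
      refine key _ (hrad w) fun i => ?_
      rw [herm_eq_zero_comm, map_sum]
      simpa [Matrix.mulVec, dotProduct, H, mul_comm] using congrFun hV i
    have hwr : w ∈ ω.perp ⊤ := fun u _ => by rw [herm_eq_zero_comm, hw]; rfl
    ext1 j
    have h2 := hφS j ⟨w, trivial⟩ hwr
    have : (⟨w, trivial⟩ : (⊤ : Submodule k[T;T⁻¹] N)) = ∑ i, V i • ⟨e i, Submodule.mem_top⟩ := by
      ext; simp [w]
    rw [this, map_sum] at h2
    simp only [map_smul, hφe, smul_eq_mul] at h2
    simpa using h2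
  refine ⟨H.det, hdet, fun Φ hΦ => ?_⟩
  -- Cramer's rule solves `c H = det H • Φ(e)`; the inversion in the witness undoes the
  -- semilinearity of `herm` on the left.
  let c : Fin r → k[T;T⁻¹] := Matrix.vecMul (fun i => Φ (e i)) H.adjugate
  refine ⟨∑ i, invert (c i) • e i, fun v => ?_⟩
  have := key (H.det • Φ - ω.herm (∑ i, invert (c i) • e i)) (fun v hv => by
    rw [LinearMap.sub_apply, hrad _ v hv, LinearMap.smul_apply, hΦ v hv]; simp) (fun j => by
    rw [LinearMap.sub_apply, herm_sum_left, sub_eq_zero]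
    simp only [herm_smul_left, involutive_invert _]
    change H.det • Φ (e j) = Matrix.vecMul c H j
    rw [Matrix.vecMul_vecMul, Matrix.adjugate_mul, Matrix.vecMul_smul, Matrix.vecMul_one]
    rfl)
  have := LinearMap.congr_fun this v
  rwa [LinearMap.sub_apply, LinearMap.zero_apply, sub_eq_zero] at this

end ChainForm

/-! ### Coarse-graining: restricting to translations by multiples of `b` -/

namespace LaurentPolynomial

variable {k : Type*} [Field k]

/-- The substitution `T ↦ T ^ b`. -/
noncomputable def expand (b : ℕ) : k[T;T⁻¹] →ₐ[k] k[T;T⁻¹] :=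
  AddMonoidAlgebra.mapDomainAlgHom k k (AddMonoidHom.mulLeft (b : ℤ))

@[simp]
theorem expand_T (b : ℕ) (n : ℤ) : expand b (T n : k[T;T⁻¹]) = T (b * n) := by
  simp [expand, T, AddMonoidAlgebra.mapDomain_single, -single_eq_C_mul_T]

end LaurentPolynomial

/-- A module over Laurent polynomials with `T` acting as `T ^ b`. -/
def Coarsened (_b : ℕ) (M : Type*) : Type _ := M

namespace Coarsened

variable {k M : Type*} [Field k] {b : ℕ} [AddCommGroup M]

instance : AddCommGroup (Coarsened b M) := inferInstanceAs (AddCommGroup M)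

instance [Module k M] : Module k (Coarsened b M) := inferInstanceAs (Module k M)

noncomputable instance [Module k[T;T⁻¹] M] : Module k[T;T⁻¹] (Coarsened b M) :=
  Module.compHom M (expand b : k[T;T⁻¹] →ₐ[k] k[T;T⁻¹]).toRingHom

/-- The identity map. -/
def of (b : ℕ) : M ≃+ Coarsened b M := AddEquiv.refl M

variable [Module k[T;T⁻¹] M]

theorem smul_of (a : k[T;T⁻¹]) (v : M) : a • of b v = of b (expand b a • v) := rfl

theorem T_smul_of (n : ℤ) (v : M) :
    (T n : k[T;T⁻¹]) • of b v = of b ((T (b * n) : k[T;T⁻¹]) • v) := by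
  rw [smul_of, expand_T]

instance [Module k M] [IsScalarTower k k[T;T⁻¹] M] :
    IsScalarTower k k[T;T⁻¹] (Coarsened b M) where
  smul_assoc c l v := by
    change of b (expand b (c • l) • (of b).symm v) = of b (c • (expand b l • (of b).symm v))
    rw [map_smul (expand b) c l, smul_assoc]

/-- Division with remainder of exponents by `b`: the translates `T ^ j • s i` with `0 ≤ j < b`
generate. -/
theorem finite (hb : 1 ≤ b) [Module.Finite k[T;T⁻¹] M] :
    Module.Finite k[T;T⁻¹] (Coarsened b M) := by
  obtain ⟨m, s, hs⟩ := Module.Finite.exists_fin (R := k[T;T⁻¹]) (M := M)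
  let g : Fin m × Fin b → Coarsened b M := fun ij => of b ((T (ij.2 : ℤ) : k[T;T⁻¹]) • s ij.1)
  refine ⟨(Submodule.fg_def).2 ⟨Set.range g, Set.finite_range g, eq_top_iff.2 fun v _ => ?_⟩⟩
  have hT : ∀ (n : ℤ) i, of b ((T n : k[T;T⁻¹]) • s i) ∈ Submodule.span k[T;T⁻¹] (Set.range g) := by
    intro n i
    have hb' : (0 : ℤ) < b := by exact_mod_cast hb
    have h0 := Int.emod_nonneg n hb'.ne'
    have h1 := Int.emod_lt_of_pos n hb'
    have h2 := Int.mul_ediv_add_emod n b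
    lift n % (b : ℤ) to ℕ using h0 with j
    have : of b ((T n : k[T;T⁻¹]) • s i) =
        (T (n / b) : k[T;T⁻¹]) • g (i, ⟨j, by exact_mod_cast h1⟩) := by
      rw [T_smul_of, smul_smul, ← T_add, h2]
    rw [this]
    exact Submodule.smul_mem _ _ (Submodule.subset_span ⟨_, rfl⟩)
  have hv : (of b).symm v ∈ Submodule.span k[T;T⁻¹] (Set.range s) := by rw [hs]; trivial
  obtain ⟨c, hc⟩ := (Submodule.mem_span_range_iff_exists_fun _).1 hv
  have : v = ∑ i, of b (c i • s i) := by
    rw [← map_sum, hc, AddEquiv.apply_symm_apply]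
  rw [this]
  refine Submodule.sum_mem _ fun i _ => ?_
  induction c i using LaurentPolynomial.induction_on' with
  | add f g hf hg => rw [add_smul, map_add]; exact add_mem hf hg
  | C_mul_T n a =>
    have : of b ((LaurentPolynomial.C a * T n : k[T;T⁻¹]) • s i) =
        (LaurentPolynomial.C a : k[T;T⁻¹]) • of b ((T n : k[T;T⁻¹]) • s i) := by
      rw [smul_of, smul_smul]
      congr 3
      exact ((expand b).commutes a).symm
    rw [this]
    exact Submodule.smul_mem _ _ (hT n i)

end Coarsened

section

variable {k M : Type*} [Field k] {b : ℕ} [AddCommGroup M] [Module k[T;T⁻¹] M]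
  {B : Submodule k[T;T⁻¹] M} (S : Submodule k[T;T⁻¹] (Coarsened b B))

/-- The underlying additive group of a coarsened submodule. -/
noncomputable def Coarsened.underlying : AddSubgroup M :=
  (S.toAddSubgroup.comap (Coarsened.of b).toAddMonoidHom).map B.subtype.toAddMonoidHom

theorem Coarsened.mem_underlying {v : M} :
    v ∈ Coarsened.underlying S ↔ ∃ h : v ∈ B, Coarsened.of b (⟨v, h⟩ : B) ∈ S := by
  constructor
  · rintro ⟨w, hw, rfl⟩
    exact ⟨w.2, hw⟩
  · rintro ⟨h, hv⟩
    exact ⟨⟨v, h⟩, hv, rfl⟩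

theorem Coarsened.expand_smul_mem_underlying (c : k[T;T⁻¹]) {v : M}
    (hv : v ∈ Coarsened.underlying S) :
    expand b c • v ∈ Coarsened.underlying S := by
  obtain ⟨h, hv⟩ := (Coarsened.mem_underlying S).1 hv
  exact (Coarsened.mem_underlying S).2 ⟨B.smul_mem _ h, S.smul_mem c hv⟩

theorem Submodule.free_and_finite_of_isPrincipalIdealRing {R N : Type*} [CommRing R] [IsDomain R]
    [IsPrincipalIdealRing R] [AddCommGroup N] [Module R N] [Module.Finite R N]
    [Module.IsTorsionFree R N] (P : Submodule R N) : Module.Free R P ∧ Module.Finite R P :=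
  ⟨inferInstance, inferInstance⟩

end

namespace ChainForm

variable {k N : Type*} [Field k] [AddCommGroup N] [Module k N] [Module k[T;T⁻¹] N]
  [IsScalarTower k k[T;T⁻¹] N] (ω : ChainForm k N)

/-- The same form, for the action of the translations by multiples of `b`. -/
def coarsen {b : ℕ} (hb : 1 ≤ b) : ChainForm k (Coarsened b N) where
  form := ω.form
  form_self := ω.form_self
  form_T_smul n u v := by
    have := ω.form_T_smul (b * n) u v
    rw [← expand_T] at this
    exact this
  finite_range u v := by
    have := (ω.finite_range u v).preimage (f := fun n : ℤ => (b : ℤ) * n)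
      (fun m _ n _ h => mul_left_cancel₀ (by positivity) h)
    refine this.subset fun n hn => ?_
    rw [Set.mem_preimage, Set.mem_ofPred_eq, ← expand_T]
    exact hn

/-- The restriction of the form to a submodule. -/
noncomputable def restrict (B : Submodule k[T;T⁻¹] N) : ChainForm k B where
  form := ω.form.domRestrict₁₂ (B.restrictScalars k) (B.restrictScalars k)
  form_self u := ω.form_self u
  form_T_smul n u v := ω.form_T_smul n u v
  finite_range u v := ω.finite_range u v

/-- A coarse functional and a fine one carry the same data, namely a finite-range functional over
`k`. So the annihilator `f` of the fine charges, and with it its multiple `T ^ b - 1`, kills the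
coarse charges; on the coarse module `T ^ b` is the action of `T`. -/
theorem exists_coarse_lagrangian [Finite k] [Module.Finite k[T;T⁻¹] N] :
    ∃ (b : ℕ) (hb : 1 ≤ b) (S : Submodule k[T;T⁻¹] (Coarsened b N)),
      (ω.coarsen hb).perp S = S := by
  obtain ⟨f, hf0, hf⟩ := ω.exists_ne_zero_mul_eq_herm
  obtain ⟨b, hb, g, hg⟩ := exists_dvd_T_sub_one hf0
  have := Coarsened.finite (k := k) (M := N) hb
  refine ⟨b, hb, (ω.coarsen hb).exists_lagrangian fun Φ hΦ => ?_⟩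
  let l : N →ₗ[k] k :=
    { toFun v := (Φ (Coarsened.of b v)).coeff 0
      map_add' u v := by rw [map_add, map_add]; rfl
      map_smul' c v := by
        have : Coarsened.of b (c • v) = (c • (1 : k[T;T⁻¹])) • Coarsened.of b v := by
          rw [smul_assoc, one_smul]; rfl
        rw [this, map_smul, smul_assoc, smul_eq_mul, one_mul]; rfl }
  have hΦl : ∀ v (n : ℤ), (Φ (Coarsened.of b v)).coeff n = l ((T (-(b * n)) : k[T;T⁻¹]) • v) := by
    intro v n
    rw [coeff_hom, Coarsened.T_smul_of, mul_neg]
    rfl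
  have hb' : (0 : ℤ) < b := by exact_mod_cast hb
  have hfin : ∀ v, {n : ℤ | l ((T n : k[T;T⁻¹]) • v) ≠ 0}.Finite := by
    intro v
    refine (Set.finite_iUnion fun j : Fin b =>
      ((Φ (Coarsened.of b ((T (j : ℤ) : k[T;T⁻¹]) • v))).coeff.hasFiniteSupport.image
        fun n : ℤ => j - b * n)).subset fun n hn => ?_
    have h0 := Int.emod_nonneg n hb'.ne'
    have h1 := Int.emod_lt_of_pos n hb'
    have h2 := Int.mul_ediv_add_emod n b
    lift n % (b : ℤ) to ℕ using h0 with j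
    refine Set.mem_iUnion.2 ⟨⟨j, by exact_mod_cast h1⟩, -(n / b), ?_, ?_⟩
    · rw [Function.mem_support, hΦl, smul_smul, ← T_add, mul_neg, neg_neg, h2]
      exact hn
    · simp only; linarith
  -- The factor `g` turns `f` into `T ^ b - 1`. The scalar form is unchanged by coarsening, so fine
  -- radical vectors are also coarse radical vectors.
  obtain ⟨u, hu⟩ := hf (g • homOfFunctional l hfin) fun v hv => by
    have : homOfFunctional l hfin v = 0 := by
      ext n
      have h1 := hΦ (Coarsened.of b ((T (-n) : k[T;T⁻¹]) • v)) (by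
        rw [mem_perp_iff_form]
        intro u _
        exact (ω.mem_perp_iff_form.1 ((ω.perp ⊤).smul_mem _ hv)) ((Coarsened.of b).symm u) trivial)
      change (Φ _).coeff 0 = _
      rw [h1]; rfl
    rw [LinearMap.smul_apply, this, smul_zero]
  refine ⟨Coarsened.of b u, fun v => ?_⟩
  obtain ⟨v, rfl⟩ := (Coarsened.of b).surjective v
  ext n
  have h1 := congrArg (fun F => F.coeff (b * n)) (hu v)
  rw [LinearMap.smul_apply, smul_eq_mul, ← mul_assoc, ← hg] at h1
  have h2 : ((ω.coarsen hb).herm (Coarsened.of b u) (Coarsened.of b v)).coeff n =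
      (ω.herm u v).coeff (b * n) := by
    rw [coeff_herm, coeff_herm, Coarsened.T_smul_of, mul_neg]; rfl
  rw [h2, ← h1]
  simp only [sub_mul, one_mul, AddMonoidAlgebra.coeff_sub, Finsupp.sub_apply, coeff_T_mul, hΦl,
    coeff_homOfFunctional]
  congr 5
  ring

end ChainForm

/-! ### The Pauli module and its coarse rings -/

namespace PauliChain

variable {p q : ℕ}

theorem antiHermitianForm_eq (v w : PauliModule p q) :
    antiHermitianForm v w = ∑ k, (invert (v (.inl k)) * w (.inr k) -
      invert (v (.inr k)) * w (.inl k)) := by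
  simp [antiHermitianForm, lambdaMatrix, dotProduct, Matrix.mulVec, Matrix.one_apply,
    ← Finset.sum_sub_distrib, ← sub_eq_add_neg]

theorem antiHermitianForm_T_smul_right (n : ℤ) (v w : PauliModule p q) :
    antiHermitianForm v ((T n : (ZMod p)[T;T⁻¹]) • w) = T n * antiHermitianForm v w := by
  simp only [antiHermitianForm_eq, Pi.smul_apply, smul_eq_mul, Finset.mul_sum]
  exact Finset.sum_congr rfl fun i _ => by ring

theorem antiHermitianForm_T_smul_left (n : ℤ) (v w : PauliModule p q) :
    antiHermitianForm ((T n : (ZMod p)[T;T⁻¹]) • v) w = T (-n) * antiHermitianForm v w := by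
  simp only [antiHermitianForm_eq, Pi.smul_apply, smul_eq_mul, Finset.mul_sum, map_mul, invert_T]
  exact Finset.sum_congr rfl fun i _ => by ring

variable (p q) in
/-- The scalar form on the Pauli module. -/
noncomputable def pauliForm [Fact p.Prime] : ChainForm (ZMod p) (PauliModule p q) where
  form := LinearMap.mk₂ (ZMod p) scalarForm
    (fun u u' v => by
      simp only [scalarForm, antiHermitianForm_eq, Pi.add_apply, map_add, add_mul,
        ← Finsupp.add_apply, ← AddMonoidAlgebra.coeff_add, ← Finset.sum_add_distrib]
      congr 2
      exact Finset.sum_congr rfl fun i _ => by ring)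
    (fun c u v => by
      simp only [scalarForm, antiHermitianForm_eq, Pi.smul_apply, map_smul, smul_mul_assoc,
        ← smul_sub, ← Finset.smul_sum]
      rfl)
    (fun u v v' => by
      simp only [scalarForm, antiHermitianForm_eq, Pi.add_apply, mul_add, ← Finsupp.add_apply,
        ← AddMonoidAlgebra.coeff_add, ← Finset.sum_add_distrib]
      congr 2
      exact Finset.sum_congr rfl fun i _ => by ring)
    (fun c u v => by
      simp only [scalarForm, antiHermitianForm_eq, Pi.smul_apply, mul_smul_comm,
        ← smul_sub, ← Finset.smul_sum]
      rfl)
  form_self u := by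
    rw [LinearMap.mk₂_apply, scalarForm, antiHermitianForm_eq, AddMonoidAlgebra.coeff_sum,
      Finsupp.finsetSum_apply]
    refine Finset.sum_eq_zero fun i _ => ?_
    have : invert (u (.inr i)) * u (.inl i) = invert (invert (u (.inl i)) * u (.inr i)) := by
      rw [map_mul, involutive_invert, mul_comm]
    rw [this, AddMonoidAlgebra.coeff_sub, Finsupp.sub_apply, invert_apply, neg_zero, sub_self]
  form_T_smul n u v := by
    rw [LinearMap.mk₂_apply, LinearMap.mk₂_apply, scalarForm, antiHermitianForm_T_smul_right,
      antiHermitianForm_T_smul_left, ← mul_assoc, ← T_add, add_neg_cancel, T_zero, one_mul]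
    rfl
  finite_range u v := by
    refine ((antiHermitianForm u v).coeff.hasFiniteSupport.preimage
      (neg_injective (G := ℤ)).injOn).subset fun n hn => ?_
    rw [Set.mem_ofPred_eq, LinearMap.mk₂_apply, scalarForm, antiHermitianForm_T_smul_right,
      coeff_T_mul, zero_sub] at hn
    exact hn

theorem expand_mem_coarseRing [Fact p.Prime] (b : ℕ) (a : (ZMod p)[T;T⁻¹]) :
    expand b a ∈ coarseRing p b := by
  have hT : ∀ n : ℤ, (T (b * n) : (ZMod p)[T;T⁻¹]) ∈ coarseRing p b := by
    intro n
    obtain ⟨m, rfl | rfl⟩ := n.eq_nat_or_neg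
    · rw [mul_comm, ← T_pow]
      exact Subalgebra.pow_mem _ (Algebra.subset_adjoin (by simp)) _
    · rw [mul_neg, mul_comm, ← mul_neg, ← T_pow]
      exact Subalgebra.pow_mem _ (Algebra.subset_adjoin (by simp)) _
  induction a using LaurentPolynomial.induction_on' with
  | add f g hf hg => rw [map_add]; exact add_mem hf hg
  | C_mul_T n c =>
    rw [← smul_eq_C_mul, map_smul, expand_T]
    exact Subalgebra.smul_mem _ (hT n) c

theorem exists_expand_eq [Fact p.Prime] {b : ℕ} {a : (ZMod p)[T;T⁻¹]} (ha : a ∈ coarseRing p b) :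
    ∃ c, expand b c = a := by
  have h : coarseRing p b ≤ (expand b : (ZMod p)[T;T⁻¹] →ₐ[ZMod p] _).range := by
    refine Algebra.adjoin_le ?_
    rintro x (rfl | rfl)
    · exact ⟨T 1, by simp⟩
    · exact ⟨T (-1), by simp⟩
  exact h ha

/-- The coarse ring is the image of the PID `R` under `T ↦ T ^ b`. -/
theorem isPrincipalIdealRing_coarseRing [Fact p.Prime] (b : ℕ) :
    IsPrincipalIdealRing (coarseRing p b) :=
  IsPrincipalIdealRing.of_surjective
    ((expand b : (ZMod p)[T;T⁻¹] →ₐ[ZMod p] _).codRestrict (coarseRing p b)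
      (expand_mem_coarseRing b)) fun a => by
    obtain ⟨c, hc⟩ := exists_expand_eq a.2
    exact ⟨c, Subtype.ext hc⟩

theorem finite_coarseRing [Fact p.Prime] {b : ℕ} (hb : 1 ≤ b) :
    Module.Finite (coarseRing p b) (PauliModule p q) := by
  have := Coarsened.finite (k := ZMod p) (M := PauliModule p q) hb
  obtain ⟨m, s, hs⟩ := Module.Finite.exists_fin (R := (ZMod p)[T;T⁻¹])
    (M := Coarsened b (PauliModule p q))
  let g : Fin m → PauliModule p q := fun i => (Coarsened.of b).symm (s i)
  refine ⟨(Submodule.fg_def).2 ⟨Set.range g, Set.finite_range g, eq_top_iff.2 fun v _ => ?_⟩⟩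
  have hv : Coarsened.of b v ∈ Submodule.span (ZMod p)[T;T⁻¹] (Set.range s) := by rw [hs]; trivial
  obtain ⟨c, hc⟩ := (Submodule.mem_span_range_iff_exists_fun _).1 hv
  refine (Submodule.mem_span_range_iff_exists_fun _).2
    ⟨fun i => ⟨expand b (c i), expand_mem_coarseRing b _⟩, ?_⟩
  have hc' := congrArg (Coarsened.of b).symm hc
  rw [map_sum, AddEquiv.symm_apply_apply] at hc'
  exact hc'

theorem free_and_finite_coarseRing [Fact p.Prime] {b : ℕ} (hb : 1 ≤ b)
    (S : Submodule (coarseRing p b) (PauliModule p q)) :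
    Module.Free (coarseRing p b) S ∧ Module.Finite (coarseRing p b) S := by
  have := isPrincipalIdealRing_coarseRing (p := p) b
  have := finite_coarseRing (p := p) (q := q) hb
  have : Module.IsTorsionFree (coarseRing p b) (PauliModule p q) :=
    Module.IsTorsionFree.of_smul_eq_zero fun a v h => by
      have h : (a : (ZMod p)[T;T⁻¹]) • v = 0 := h
      rcases smul_eq_zero.1 h with h | h
      · exact Or.inl (Subtype.ext h)
      · exact Or.inr h
  exact S.free_and_finite_of_isPrincipalIdealRing

/-- A coarsened submodule, as a module over the coarse ring. -/
noncomputable def ofCoarsened [Fact p.Prime] {b : ℕ}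
    {B : Submodule (ZMod p)[T;T⁻¹] (PauliModule p q)}
    (S : Submodule (ZMod p)[T;T⁻¹] (Coarsened b B)) :
    Submodule (coarseRing p b) (PauliModule p q) :=
  { (Coarsened.underlying S).toAddSubmonoid with
    smul_mem' := by
      intro a v hv
      obtain ⟨c, hc⟩ := exists_expand_eq a.2
      have : a • v = expand b c • v := by rw [hc]; rfl
      rw [this]
      exact Coarsened.expand_smul_mem_underlying S c hv }

theorem mem_ofCoarsened [Fact p.Prime] {b : ℕ}
    {B : Submodule (ZMod p)[T;T⁻¹] (PauliModule p q)}
    {S : Submodule (ZMod p)[T;T⁻¹] (Coarsened b B)} {v : PauliModule p q} :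
    v ∈ ofCoarsened S ↔ ∃ h : v ∈ B, Coarsened.of b (⟨v, h⟩ : B) ∈ S :=
  (Coarsened.mem_underlying S)

/-- The form is restricted to `B = A^⊥`, where being Lagrangian means exactly `S^⊥ ∩ A^⊥ = S`. -/
theorem exists_lagrangian_perp [Fact p.Prime]
    (A : Submodule (ZMod p)[T;T⁻¹] (PauliModule p q)) :
    ∃ b : ℕ, 1 ≤ b ∧ ∃ S : Submodule (coarseRing p b) (PauliModule p q),
      (S : Set (PauliModule p q)) ⊆ perp (A : Set (PauliModule p q)) ∧
      perp (S : Set (PauliModule p q)) ∩ perp (A : Set (PauliModule p q)) =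
        (S : Set (PauliModule p q)) := by
  obtain ⟨B, hB⟩ : ∃ B : Submodule (ZMod p)[T;T⁻¹] (PauliModule p q),
      ∀ v, v ∈ B ↔ v ∈ perp (A : Set (PauliModule p q)) :=
    ⟨(pauliForm p q).perp A, fun v => (pauliForm p q).mem_perp_iff_form⟩
  obtain ⟨b, hb, S, hS⟩ := ((pauliForm p q).restrict B).exists_coarse_lagrangian
  have hS' : ∀ v : B, Coarsened.of b v ∈ S ↔
      ∀ u : B, Coarsened.of b u ∈ S → scalarForm (u : PauliModule p q) v = 0 := by
    intro v
    conv_lhs => rw [← hS]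
    exact ChainForm.mem_perp_iff_form _
  refine ⟨b, hb, ofCoarsened S, fun v hv => ?_, ?_⟩
  · exact (hB v).1 (mem_ofCoarsened.1 hv).1
  · ext v
    constructor
    · rintro ⟨h1, h2⟩
      exact mem_ofCoarsened.2 ⟨(hB v).2 h2, (hS' _).2 fun u hu => h1 u (mem_ofCoarsened.2 ⟨u.2, hu⟩)⟩
    · intro hv
      obtain ⟨h, hvS⟩ := mem_ofCoarsened.1 hv
      refine ⟨fun u hu => ?_, (hB v).1 h⟩
      obtain ⟨hu, huS⟩ := mem_ofCoarsened.1 hu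
      exact (hS' _).1 hvS ⟨u, hu⟩ huS

end PauliChain

/-- An additive subgroup of a module over Laurent polynomials over `ZMod p` that contains all
translates of a vector contains all its multiples. -/
theorem AddSubgroup.laurent_smul_mem {p : ℕ} [Fact p.Prime] {M : Type*} [AddCommGroup M]
    [Module (ZMod p)[T;T⁻¹] M] (W : AddSubgroup M) {v : M}
    (h : ∀ n : ℤ, (T n : (ZMod p)[T;T⁻¹]) • v ∈ W) (a : (ZMod p)[T;T⁻¹]) : a • v ∈ W := by
  induction a using LaurentPolynomial.induction_on' with
  | add f g hf hg => rw [add_smul]; exact W.add_mem hf hg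
  | C_mul_T n c =>
    -- Scalars of the prime field act as natural multiples, so additive closure suffices.
    have : (LaurentPolynomial.C c : (ZMod p)[T;T⁻¹]) = (c.val : (ZMod p)[T;T⁻¹]) := by
      rw [← map_natCast (LaurentPolynomial.C (R := ZMod p)), ZMod.natCast_zmod_val]
    rw [mul_smul, this, Nat.cast_smul_eq_nsmul]
    exact W.nsmul_mem (h n) _

/-! ### Pauli operators as Weyl operators -/

namespace PauliChain

variable {p q : ℕ}

/-- The displacement of configurations by the `X`-part of a vector. -/
def xPart (u : PauliModule p q) : Config p q := fun i => (u (.inl i.2)).coeff i.1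

/-- The pairing of the `Z`-part of a vector with a configuration. -/
noncomputable def zPairing (u : PauliModule p q) (s : Config p q) : ZMod p :=
  ∑ k, (u (.inr k)).coeff.sum fun j c => c * s (j, k)

theorem xPart_add (u v : PauliModule p q) : xPart (u + v) = xPart u + xPart v := rfl

theorem xPart_zero : xPart (0 : PauliModule p q) = 0 := rfl

theorem xPart_neg (u : PauliModule p q) : xPart (-u) = -xPart u := rfl

theorem zPairing_add_left (u v : PauliModule p q) (s : Config p q) :
    zPairing (u + v) s = zPairing u s + zPairing v s := by
  rw [zPairing, zPairing, zPairing, ← Finset.sum_add_distrib]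
  exact Finset.sum_congr rfl fun k _ =>
    Finsupp.sum_add_index' (fun _ => zero_mul _) fun _ _ _ => add_mul _ _ _

theorem zPairing_add_right (u : PauliModule p q) (s t : Config p q) :
    zPairing u (s + t) = zPairing u s + zPairing u t := by
  simp [zPairing, mul_add, Finsupp.sum_add, Finset.sum_add_distrib]

theorem zPairing_zero_left (s : Config p q) : zPairing (0 : PauliModule p q) s = 0 := by
  simp [zPairing]

theorem zPairing_zero_right (u : PauliModule p q) : zPairing u 0 = 0 := by
  simp [zPairing]

theorem zPairing_neg_left (u : PauliModule p q) (s : Config p q) :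
    zPairing (-u) s = -zPairing u s := by
  rw [eq_neg_iff_add_eq_zero, ← zPairing_add_left, neg_add_cancel, zPairing_zero_left]

theorem zPairing_neg_right (u : PauliModule p q) (s : Config p q) :
    zPairing u (-s) = -zPairing u s := by
  rw [eq_neg_iff_add_eq_zero, ← zPairing_add_right, neg_add_cancel, zPairing_zero_right]

theorem zPairing_single (u : PauliModule p q) (j : ℤ) (k : Fin q) :
    zPairing u (Pi.single (j, k) 1) = (u (.inr k)).coeff j := by
  rw [zPairing, Finset.sum_eq_single k]
  · rw [Finsupp.sum, Finset.sum_eq_single j]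
    · simp
    · intro i _ hi
      rw [Pi.single_eq_of_ne (by simpa using hi), mul_zero]
    · intro h
      rw [Finsupp.notMem_support_iff.1 h, zero_mul]
  · intro l _ hl
    refine Finset.sum_eq_zero fun i _ => ?_
    simp [hl]
  · simp

theorem coeff_zero_invert_mul (f g : (ZMod p)[T;T⁻¹]) :
    (invert f * g).coeff 0 = g.coeff.sum fun j c => c * f.coeff j := by
  induction g using LaurentPolynomial.induction_on' with
  | add g h hg hh =>
    rw [mul_add, AddMonoidAlgebra.coeff_add, Finsupp.add_apply, hg, hh, AddMonoidAlgebra.coeff_add,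
      Finsupp.sum_add_index' (fun _ => zero_mul _) fun _ _ _ => add_mul _ _ _]
  | C_mul_T n c =>
    rw [← single_eq_C_mul_T, AddMonoidAlgebra.coeff_mul_single_apply,
      AddMonoidAlgebra.coeff_single, Finsupp.sum_single_index (zero_mul _), invert_apply, mul_comm]
    simp

/-- The two pairings are, in reverse order, the phase exponents of `U * V` and `V * U`, so the form
measures the commutator. -/
theorem scalarForm_eq (u v : PauliModule p q) :
    scalarForm u v = zPairing v (xPart u) - zPairing u (xPart v) := by
  rw [scalarForm, antiHermitianForm_eq, AddMonoidAlgebra.coeff_sum, Finsupp.finsetSum_apply,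
    zPairing, zPairing, ← Finset.sum_sub_distrib]
  refine Finset.sum_congr rfl fun k _ => ?_
  rw [AddMonoidAlgebra.coeff_sub, Finsupp.sub_apply, coeff_zero_invert_mul]
  have : invert (u (.inr k)) * v (.inl k) = invert (invert (v (.inl k)) * u (.inr k)) := by
    rw [map_mul, involutive_invert, mul_comm]
  rw [this, invert_apply, neg_zero, coeff_zero_invert_mul]
  rfl

/-- Translation of configurations. -/
def shiftConfig (n : ℤ) (s : Config p q) : Config p q := fun i => s (i.1 - n, i.2)

theorem xPart_T_smul (n : ℤ) (u : PauliModule p q) :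
    xPart ((T n : (ZMod p)[T;T⁻¹]) • u) = shiftConfig n (xPart u) := by
  ext i
  exact coeff_T_mul _ _ _

theorem zPairing_T_smul (n : ℤ) (u : PauliModule p q) (s : Config p q) :
    zPairing ((T n : (ZMod p)[T;T⁻¹]) • u) s = zPairing u (shiftConfig (-n) s) := by
  rw [zPairing, zPairing]
  refine Finset.sum_congr rfl fun k _ => ?_
  rw [Pi.smul_apply, smul_eq_mul]
  induction u (.inr k) using LaurentPolynomial.induction_on' with
  | add g h hg hh =>
    rw [mul_add, AddMonoidAlgebra.coeff_add, AddMonoidAlgebra.coeff_add,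
      Finsupp.sum_add_index' (fun _ => zero_mul _) fun _ _ _ => add_mul _ _ _,
      Finsupp.sum_add_index' (fun _ => zero_mul _) fun _ _ _ => add_mul _ _ _, hg, hh]
  | C_mul_T m c =>
    rw [mul_left_comm, ← T_add, ← single_eq_C_mul_T, ← single_eq_C_mul_T,
      AddMonoidAlgebra.coeff_single, AddMonoidAlgebra.coeff_single,
      Finsupp.sum_single_index (zero_mul _), Finsupp.sum_single_index (zero_mul _), shiftConfig]
    congr 2
    simp only [Prod.mk.injEq, and_true]
    ring

variable {Γ : Subgroup Circle} {I : Set ℤ}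

theorem op_ext {U V : Op p q} (h : ∀ s, U (Finsupp.single s 1) = V (Finsupp.single s 1)) :
    U = V := by
  apply LinearEquiv.toLinearMap_injective
  ext1 s
  ext1
  exact h s

theorem opPhase_mem_pauliOn {c : Circle} (hc : c ∈ Γ) : opPhase p q c ∈ pauliOn p q Γ I :=
  Subgroup.subset_closure (Or.inl ⟨c, hc, rfl⟩)

theorem opX_mem_pauliOn {j : ℤ} (hj : j ∈ I) (k : Fin q) : opX p (j, k) ∈ pauliOn p q Γ I :=
  Subgroup.subset_closure (Or.inr ⟨j, hj, k, Or.inl rfl⟩)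

theorem opZ_mem_pauliOn {j : ℤ} (hj : j ∈ I) (k : Fin q) : opZ p (j, k) ∈ pauliOn p q Γ I :=
  Subgroup.subset_closure (Or.inr ⟨j, hj, k, Or.inr rfl⟩)

theorem pauliOn_le_pauliGroup : pauliOn p q Γ I ≤ pauliGroup p q Γ :=
  Subgroup.closure_mono (Set.union_subset_union_right _ fun _ ⟨j, _, h⟩ => ⟨j, trivial, h⟩)

variable [Fact p.Prime]

theorem stdAddChar_ne_zero (a : ZMod p) : (ZMod.stdAddChar a : ℂ) ≠ 0 :=
  (ZMod.stdAddChar.val_isUnit a).ne_zero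

/-- The operator `U` is `c` times the Weyl operator of the vector `u`. -/
def IsWeyl (U : Op p q) (u : PauliModule p q) (c : ℂ) : Prop :=
  ∀ s, U (Finsupp.single s 1) =
    Finsupp.single (s + xPart u) (c * ZMod.stdAddChar (zPairing u s))

namespace IsWeyl

variable {U V : Op p q} {u v : PauliModule p q} {c d : ℂ}

theorem apply_single (hU : IsWeyl U u c) (s : Config p q) (a : ℂ) :
    U (Finsupp.single s a) =
      Finsupp.single (s + xPart u) (a * (c * ZMod.stdAddChar (zPairing u s))) := by
  have : Finsupp.single s a = a • Finsupp.single s (1 : ℂ) := by simp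
  rw [this, map_smul, hU s, Finsupp.smul_single, smul_eq_mul]

theorem eq (hU : IsWeyl U u c) (hV : IsWeyl V u c) : U = V :=
  op_ext fun s => by rw [hU s, hV s]

protected theorem one : IsWeyl (1 : Op p q) 0 1 := fun s => by
  simp [zPairing_zero_left, xPart_zero]

protected theorem mul (hU : IsWeyl U u c) (hV : IsWeyl V v d) :
    IsWeyl (U * V) (u + v) (c * d * ZMod.stdAddChar (zPairing u (xPart v))) := fun s => by
  rw [LinearEquiv.mul_apply, hV s, hU.apply_single, xPart_add, zPairing_add_right,
    zPairing_add_left, AddChar.map_add_eq_mul, AddChar.map_add_eq_mul, add_assoc,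
    add_comm (xPart u)]
  congr 1
  ring

protected theorem inv (hU : IsWeyl U u c) (hc : c ≠ 0) :
    IsWeyl U⁻¹ (-u) (c⁻¹ * ZMod.stdAddChar (zPairing u (xPart u))) := fun s => by
  have : U⁻¹ = U.symm := rfl
  rw [this, LinearEquiv.symm_apply_eq, hU.apply_single, xPart_neg, neg_add_cancel_right,
    zPairing_neg_left, zPairing_add_right, zPairing_neg_right]
  congr 1
  have h : c⁻¹ * ZMod.stdAddChar (zPairing u (xPart u)) * ZMod.stdAddChar (-zPairing u s) *
      (c * ZMod.stdAddChar (zPairing u s + -zPairing u (xPart u))) =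
      c⁻¹ * c * ZMod.stdAddChar (zPairing u (xPart u) + (-zPairing u s +
        (zPairing u s + -zPairing u (xPart u)))) := by
    simp only [AddChar.map_add_eq_mul]; ring
  rw [h, inv_mul_cancel₀ hc, one_mul]
  simp

theorem injective (hU : IsWeyl U u c) (hU' : IsWeyl U v d) (hc : c ≠ 0) : u = v ∧ c = d := by
  have h0 := (hU 0).symm.trans (hU' 0)
  rw [zPairing_zero_right, zPairing_zero_right, AddChar.map_zero_eq_one, mul_one, mul_one,
    zero_add, zero_add, Finsupp.single_eq_single_iff] at h0
  rcases h0 with ⟨hx, rfl⟩ | ⟨h, -⟩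
  · refine ⟨?_, rfl⟩
    funext k
    ext j
    rcases k with k | k
    · exact congrFun hx (j, k)
    -- The zero configuration has fixed the `X`-part and the scalar; unit configurations now read
    -- off the coefficients of the `Z`-part.
    · have h1 := (hU (Pi.single (j, k) 1)).symm.trans (hU' (Pi.single (j, k) 1))
      rw [hx, zPairing_single, zPairing_single] at h1
      exact ZMod.injective_stdAddChar (mul_left_cancel₀ hc (Finsupp.single_injective _ h1))
  · exact absurd h hc

theorem commute_iff (hU : IsWeyl U u c) (hV : IsWeyl V v d) (hc : c ≠ 0) (hd : d ≠ 0) :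
    U * V = V * U ↔ scalarForm u v = 0 := by
  have h1 := hU.mul hV
  have h2 := hV.mul hU
  rw [add_comm v u, mul_comm d c] at h2
  have hcd : c * d ≠ 0 := mul_ne_zero hc hd
  rw [scalarForm_eq, sub_eq_zero]
  constructor
  · intro h
    rw [h] at h1
    have hne : c * d * ZMod.stdAddChar (zPairing v (xPart u)) ≠ 0 :=
      mul_ne_zero hcd (stdAddChar_ne_zero _)
    exact ZMod.injective_stdAddChar (mul_left_cancel₀ hcd (h2.injective h1 hne).2)
  · intro h
    rw [h] at h2
    exact h1.eq h2

theorem mul_inv_same (hU : IsWeyl U u c) (hV : IsWeyl V u d) (hd : d ≠ 0) :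
    IsWeyl (U * V⁻¹) 0 (c / d) := by
  have h := hU.mul (hV.inv hd)
  rw [add_neg_cancel, xPart_neg, zPairing_neg_right, ← mul_assoc, mul_assoc,
    ← AddChar.map_add_eq_mul, add_neg_cancel, AddChar.map_zero_eq_one, mul_one] at h
  exact h

theorem opPhase (c : Circle) : IsWeyl (opPhase p q c) 0 c := fun s => by
  rw [zPairing_zero_left, xPart_zero, AddChar.map_zero_eq_one, mul_one, add_zero]
  change (c : ℂ) • Finsupp.single s (1 : ℂ) = _
  simp

theorem opX (j : ℤ) (k : Fin q) : IsWeyl (opX p (j, k)) (Pi.single (.inl k) (T j)) 1 := fun s => by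
  have h1 : zPairing (Pi.single (.inl k) (T j) : PauliModule p q) s = 0 := by simp [zPairing]
  have h2 : xPart (Pi.single (.inl k) (T j) : PauliModule p q) = Pi.single (j, k) 1 := by
    ext ⟨i, l⟩
    by_cases hl : l = k
    · subst hl
      by_cases hi : i = j
      · subst hi; simp [xPart]
      · simp [xPart, hi, Ne.symm hi]
    · simp [xPart, hl]
  rw [h1, h2, AddChar.map_zero_eq_one, mul_one]
  exact Finsupp.domLCongr_single _ _ _

theorem opZ (j : ℤ) (k : Fin q) : IsWeyl (opZ p (j, k)) (Pi.single (.inr k) (T j)) 1 := fun s => by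
  have h1 : xPart (Pi.single (.inr k) (T j) : PauliModule p q) = 0 := by
    ext ⟨i, l⟩; simp [xPart]
  have h2 : zPairing (Pi.single (.inr k) (T j) : PauliModule p q) s = s (j, k) := by
    rw [zPairing, Finset.sum_eq_single k]
    · rw [Pi.single_eq_same, T, AddMonoidAlgebra.coeff_single,
        Finsupp.sum_single_index (zero_mul _), one_mul]
    · intro l _ hl
      rw [Pi.single_eq_of_ne (by simpa using hl)]
      simp
    · simp
  rw [h1, h2, add_zero, one_mul]
  change diagMap _ _ = _
  rw [diagMap_single, mul_one, Units.val_mk0]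
  congr 1
  have h := ZMod.stdAddChar_coe (N := p) ((s (j, k)).val : ℤ)
  rw [Int.cast_natCast, ZMod.natCast_zmod_val] at h
  rw [h, Int.cast_natCast]

theorem translate (hU : IsWeyl U u c) (n : ℤ) :
    IsWeyl (translate n U) ((T n : (ZMod p)[T;T⁻¹]) • u) c := fun s => by
  have h1 : ∀ (t : Config p q) (a : ℂ), opShift p q n (Finsupp.single t a) =
      Finsupp.single (shiftConfig n t) a := by
    intro t a
    exact Finsupp.domLCongr_single _ _ _
  have h2 : (opShift p q n)⁻¹ (Finsupp.single s 1) = Finsupp.single (shiftConfig (-n) s) 1 := by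
    have : (opShift p q n)⁻¹ = (opShift p q n).symm := rfl
    rw [this, LinearEquiv.symm_apply_eq, h1]
    congr 1
    ext ⟨i, k⟩
    simp [shiftConfig]
  rw [PauliChain.translate, LinearEquiv.mul_apply, LinearEquiv.mul_apply, h2, hU, h1,
    zPairing_T_smul, xPart_T_smul]
  congr 1
  ext ⟨i, k⟩
  simp [shiftConfig]

end IsWeyl

/-- The vectors of the Weyl operators in a group, up to scalars. -/
def weylVectors (K : Subgroup (Op p q)) : AddSubgroup (PauliModule p q) where
  carrier := {u | ∃ U ∈ K, ∃ c : ℂ, c ≠ 0 ∧ IsWeyl U u c}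
  add_mem' := by
    rintro u v ⟨U, hU, c, hc, h⟩ ⟨V, hV, d, hd, h'⟩
    exact ⟨U * V, K.mul_mem hU hV, _, mul_ne_zero (mul_ne_zero hc hd) (stdAddChar_ne_zero _),
      h.mul h'⟩
  zero_mem' := ⟨1, K.one_mem, 1, one_ne_zero, IsWeyl.one⟩
  neg_mem' := by
    rintro u ⟨U, hU, c, hc, h⟩
    exact ⟨U⁻¹, K.inv_mem hU, _, mul_ne_zero (inv_ne_zero hc) (stdAddChar_ne_zero _), h.inv hc⟩

theorem mem_weylVectors {K : Subgroup (Op p q)} {u : PauliModule p q} :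
    u ∈ weylVectors K ↔ ∃ U ∈ K, ∃ c : ℂ, c ≠ 0 ∧ IsWeyl U u c := Iff.rfl

theorem mem_weylVectors_pauliOn {u : PauliModule p q}
    (hu : ∀ k j, (u k).coeff j ≠ 0 → j ∈ I) : u ∈ weylVectors (pauliOn p q Γ I) := by
  have hT : ∀ k, ∀ j ∈ I,
      (Pi.single k (T j) : PauliModule p q) ∈ weylVectors (pauliOn p q Γ I) := by
    rintro (k | k) j hj
    · exact ⟨_, opX_mem_pauliOn hj k, 1, one_ne_zero, IsWeyl.opX j k⟩
    · exact ⟨_, opZ_mem_pauliOn hj k, 1, one_ne_zero, IsWeyl.opZ j k⟩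
  rw [← Finset.univ_sum_single u]
  refine AddSubgroup.sum_mem _ fun k _ => ?_
  have h1 : u k = ∑ j ∈ (u k).coeff.support, ((u k).coeff j).val • T j := by
    ext i
    have h : ∀ j, ((u k).coeff j).val • (T j : (ZMod p)[T;T⁻¹]) = .single j ((u k).coeff j) := by
      intro j
      rw [← Nat.cast_smul_eq_nsmul (ZMod p), ZMod.natCast_zmod_val, smul_eq_C_mul,
        single_eq_C_mul_T]
    simp only [h, AddMonoidAlgebra.coeff_sum, Finsupp.finsetSum_apply,
      AddMonoidAlgebra.coeff_single, Finsupp.single_apply]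
    simp
  rw [h1]
  have h2 : ∀ f : (ZMod p)[T;T⁻¹], Pi.single k f = AddMonoidHom.single
    (fun _ : Fin q ⊕ Fin q => (ZMod p)[T;T⁻¹]) k f := fun _ => rfl
  rw [h2, map_sum]
  refine AddSubgroup.sum_mem _ fun j hj => ?_
  rw [map_nsmul]
  exact AddSubgroup.nsmul_mem _ (hT k j (hu k j (Finsupp.mem_support_iff.1 hj))) _

/-- All commutator phases are realized on any nonempty set of sites. -/
theorem exists_isWeyl_zero_stdAddChar (hI : I.Nonempty) (u : PauliModule p q) (s : Config p q) :
    ∃ U ∈ pauliOn p q Γ I, IsWeyl U 0 (ZMod.stdAddChar (zPairing u s)) := by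
  obtain ⟨j, hj⟩ := hI
  rcases Nat.eq_zero_or_pos q with rfl | hq
  · refine ⟨1, Subgroup.one_mem _, ?_⟩
    have : zPairing u s = 0 := by simp [zPairing]
    rw [this, AddChar.map_zero_eq_one]
    exact IsWeyl.one
  · let k : Fin q := ⟨0, hq⟩
    have hX := IsWeyl.opX (p := p) j k
    have hZ := IsWeyl.opZ (p := p) j k
    have hXZ := hX.mul hZ
    have hZX := hZ.mul hX
    rw [add_comm] at hZX
    have h1 : zPairing (Pi.single (.inr k) (T j) : PauliModule p q)
        (xPart (Pi.single (.inl k) (T j))) = 1 := by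
      have : xPart (Pi.single (.inl k) (T j) : PauliModule p q) = Pi.single (j, k) 1 := by
        ext ⟨i, l⟩
        by_cases hl : l = k
        · subst hl
          by_cases hi : i = j
          · subst hi; simp [xPart]
          · simp [xPart, hi, Ne.symm hi]
        · simp [xPart, hl]
      rw [this, zPairing_single]
      simp
    have h2 : zPairing (Pi.single (.inl k) (T j) : PauliModule p q)
        (xPart (Pi.single (.inr k) (T j))) = 0 := by
      simp [zPairing]
    rw [h1] at hZX
    rw [h2, AddChar.map_zero_eq_one] at hXZ
    have h := hZX.mul_inv_same hXZ (by simp)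
    have hmem : opZ p (j, k) * opX p (j, k) * (opX p (j, k) * opZ p (j, k))⁻¹ ∈ pauliOn p q Γ I :=
      Subgroup.mul_mem _ (Subgroup.mul_mem _ (opZ_mem_pauliOn hj k) (opX_mem_pauliOn hj k))
        (Subgroup.inv_mem _
          (Subgroup.mul_mem _ (opX_mem_pauliOn hj k) (opZ_mem_pauliOn hj k)))
    generalize opZ p (j, k) * opX p (j, k) * (opX p (j, k) * opZ p (j, k))⁻¹ = W at h hmem
    rw [one_mul, one_mul, mul_one, div_one] at h
    -- `W` is the commutator of `Z` and `X` on one qudit, the scalar `exp (2πi / p)`; its powers are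
    -- all the phases needed, even for trivial `Γ`.
    refine ⟨W ^ (zPairing u s).val, Subgroup.pow_mem _ hmem _, ?_⟩
    have hpow : ∀ n : ℕ, IsWeyl (W ^ n) 0 (ZMod.stdAddChar ((n : ℕ) : ZMod p)) := by
      intro n
      induction n with
      | zero => simpa using IsWeyl.one
      | succ n ih =>
        have := ih.mul h
        rw [add_zero, zPairing_zero_left, AddChar.map_zero_eq_one, mul_one,
          ← AddChar.map_add_eq_mul] at this
        rw [pow_succ, Nat.cast_succ]
        exact this
    simpa using hpow (zPairing u s).val

/-- Every Pauli operator is a Weyl operator, with a phase realized on any nonempty set of sites. -/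
theorem exists_isWeyl_of_mem_pauliGroup (hI : I.Nonempty) {U : Op p q}
    (hU : U ∈ pauliGroup p q Γ) :
    ∃ u c, c ≠ 0 ∧ IsWeyl U u c ∧ ∃ V ∈ pauliOn p q Γ I, IsWeyl V 0 c := by
  have hmul : ∀ {V W : Op p q} {c d : ℂ}, IsWeyl V 0 c → IsWeyl W 0 d →
      IsWeyl (V * W) 0 (c * d) := by
    intro V W c d hV hW
    have := hV.mul hW
    rwa [add_zero, zPairing_zero_left, AddChar.map_zero_eq_one, mul_one] at this
  induction hU using Subgroup.closure_induction with
  | mem x hx =>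
    rcases hx with ⟨c, hc, rfl⟩ | ⟨j, -, k, rfl | rfl⟩
    · exact ⟨0, c, by simp, IsWeyl.opPhase c, _, opPhase_mem_pauliOn hc, IsWeyl.opPhase c⟩
    · exact ⟨_, 1, one_ne_zero, IsWeyl.opX j k, 1, Subgroup.one_mem _, IsWeyl.one⟩
    · exact ⟨_, 1, one_ne_zero, IsWeyl.opZ j k, 1, Subgroup.one_mem _, IsWeyl.one⟩
  | one => exact ⟨0, 1, one_ne_zero, IsWeyl.one, 1, Subgroup.one_mem _, IsWeyl.one⟩
  | mul x y _ _ hx hy =>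
    obtain ⟨u, c, hc, hx, V, hV, hVc⟩ := hx
    obtain ⟨v, d, hd, hy, W, hW, hWd⟩ := hy
    obtain ⟨Y, hY, hYa⟩ := exists_isWeyl_zero_stdAddChar (Γ := Γ) hI u (xPart v)
    exact ⟨_, _, mul_ne_zero (mul_ne_zero hc hd) (stdAddChar_ne_zero _), hx.mul hy,
      V * W * Y, Subgroup.mul_mem _ (Subgroup.mul_mem _ hV hW) hY, hmul (hmul hVc hWd) hYa⟩
  | inv x _ hx =>
    obtain ⟨u, c, hc, hx, V, hV, hVc⟩ := hx
    obtain ⟨Y, hY, hYa⟩ := exists_isWeyl_zero_stdAddChar (Γ := Γ) hI u (xPart u)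
    have hVi := hVc.inv hc
    rw [neg_zero, zPairing_zero_left, AddChar.map_zero_eq_one, mul_one] at hVi
    exact ⟨_, _, mul_ne_zero (inv_ne_zero hc) (stdAddChar_ne_zero _), hx.inv hc,
      V⁻¹ * Y, Subgroup.mul_mem _ (Subgroup.inv_mem _ hV) hY, hmul hVi hYa⟩

/-- A product of generators on `I` has the same vector as `U`, and the scalar by which they differ
is itself realized on `I`. -/
theorem mem_pauliOn_of_isWeyl (hI : I.Nonempty) {U : Op p q} (hU : U ∈ pauliGroup p q Γ)
    {u : PauliModule p q} {c : ℂ} (h : IsWeyl U u c)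
    (hu : ∀ k j, (u k).coeff j ≠ 0 → j ∈ I) : U ∈ pauliOn p q Γ I := by
  obtain ⟨V, hV, d, hd, hVd⟩ := mem_weylVectors_pauliOn (Γ := Γ) hu
  have hUV := h.mul_inv_same hVd hd
  obtain ⟨w, e, he, hw, W, hW, hWe⟩ := exists_isWeyl_of_mem_pauliGroup hI
    (Subgroup.mul_mem _ hU (Subgroup.inv_mem _ (pauliOn_le_pauliGroup hV)))
  obtain ⟨rfl, rfl⟩ := hw.injective hUV he
  have : U * V⁻¹ = W := hUV.eq hWe
  rw [← inv_mul_cancel_right U V, this]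
  exact Subgroup.mul_mem _ hW hV

theorem translate_mem_pauliGroup (n : ℤ) {U : Op p q} (hU : U ∈ pauliGroup p q Γ) :
    translate n U ∈ pauliGroup p q Γ := by
  induction hU using Subgroup.closure_induction with
  | mem x hx =>
    rcases hx with ⟨c, hc, rfl⟩ | ⟨j, -, k, rfl | rfl⟩
    · have h := (IsWeyl.opPhase (p := p) (q := q) c).translate n
      rw [smul_zero] at h
      rw [h.eq (IsWeyl.opPhase c)]
      exact opPhase_mem_pauliOn hc
    · have h := (IsWeyl.opX (p := p) j k).translate n
      rw [← Pi.single_smul, smul_eq_mul, ← T_add] at h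
      rw [h.eq (IsWeyl.opX (n + j) k)]
      exact opX_mem_pauliOn (Set.mem_univ _) k
    · have h := (IsWeyl.opZ (p := p) j k).translate n
      rw [← Pi.single_smul, smul_eq_mul, ← T_add] at h
      rw [h.eq (IsWeyl.opZ (n + j) k)]
      exact opZ_mem_pauliOn (Set.mem_univ _) k
  | one =>
    rw [translate, mul_one, mul_inv_cancel]
    exact Subgroup.one_mem _
  | mul x y _ _ hx hy =>
    have : translate n (x * y) = translate n x * translate n y := by
      simp only [translate]; group
    rw [this]
    exact Subgroup.mul_mem _ hx hy
  | inv x _ hx =>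
    have : translate n x⁻¹ = (translate n x)⁻¹ := by
      simp only [translate]; group
    rw [this]
    exact Subgroup.inv_mem _ hx

/-- The module of vectors of a translation-invariant group. -/
def vectorModule (G : Subgroup (Op p q)) (hG : IsTranslationInvariant 1 (G : Set (Op p q))) :
    Submodule (ZMod p)[T;T⁻¹] (PauliModule p q) :=
  { (weylVectors G).toAddSubmonoid with
    smul_mem' := by
      rintro a u ⟨U, hU, c, hc, h⟩
      refine (weylVectors G).laurent_smul_mem (fun n => ?_) a
      have := hG n U hU
      rw [Nat.cast_one, one_mul] at this
      exact ⟨_, this, c, hc, h.translate n⟩ }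

variable (Γ) in
/-- The group of all Pauli operators with vectors in a given additive group. -/
def pauliWithVectors (W : AddSubgroup (PauliModule p q)) : Subgroup (Op p q) where
  carrier := {U | U ∈ pauliGroup p q Γ ∧ ∃ u ∈ W, ∃ c : ℂ, c ≠ 0 ∧ IsWeyl U u c}
  mul_mem' := by
    rintro U V ⟨hU, u, hu, c, hc, h⟩ ⟨hV, v, hv, d, hd, h'⟩
    exact ⟨Subgroup.mul_mem _ hU hV, _, W.add_mem hu hv, _,
      mul_ne_zero (mul_ne_zero hc hd) (stdAddChar_ne_zero _), h.mul h'⟩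
  one_mem' := ⟨Subgroup.one_mem _, 0, W.zero_mem, 1, one_ne_zero, IsWeyl.one⟩
  inv_mem' := by
    rintro U ⟨hU, u, hu, c, hc, h⟩
    exact ⟨Subgroup.inv_mem _ hU, _, W.neg_mem hu, _,
      mul_ne_zero (inv_ne_zero hc) (stdAddChar_ne_zero _), h.inv hc⟩

theorem exists_mem_pauliWithVectors {W : AddSubgroup (PauliModule p q)} {u : PauliModule p q}
    (hu : u ∈ W) : ∃ U ∈ pauliWithVectors Γ W, ∃ c : ℂ, c ≠ 0 ∧ IsWeyl U u c := by
  obtain ⟨U, hU, c, hc, h⟩ := mem_weylVectors_pauliOn (Γ := Γ) (I := Set.univ) (u := u)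
    fun _ _ _ => trivial
  exact ⟨U, ⟨hU, u, hu, c, hc, h⟩, c, hc, h⟩

/-- A finitely generated coarse module of vectors gives a locally generated group. -/
theorem exists_local_generators {b : ℕ} (S : Submodule (coarseRing p b) (PauliModule p q))
    [Module.Finite (coarseRing p b) S] :
    ∃ M : Set (Op p q), IsLocalPauliSet Γ M ∧ IsTranslationInvariant b M ∧
      Subgroup.closure M = pauliWithVectors Γ S.toAddSubgroup := by
  obtain ⟨m, s, hs⟩ := Module.Finite.exists_fin (R := coarseRing p b) (M := S)
  -- The vector `0` puts every scalar of the Pauli group among the generators, so the closure is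
  -- determined by its vectors alone.
  let E : Set (PauliModule p q) :=
    {u | u = 0 ∨ ∃ (n : ℤ) (i : Fin m),
      u = (T (b * n) : (ZMod p)[T;T⁻¹]) • (s i : PauliModule p q)}
  let M : Set (Op p q) :=
    {U | U ∈ pauliGroup p q Γ ∧ ∃ u ∈ E, ∃ c : ℂ, c ≠ 0 ∧ IsWeyl U u c}
  have hTS : ∀ (n : ℤ) {v : PauliModule p q}, v ∈ S →
      (T (b * n) : (ZMod p)[T;T⁻¹]) • v ∈ S := by
    intro n v hv
    rw [← expand_T]
    exact S.smul_mem ⟨_, expand_mem_coarseRing b _⟩ hv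
  have hES : ∀ u ∈ E, u ∈ S := by
    rintro u (rfl | ⟨n, i, rfl⟩)
    · exact S.zero_mem
    · exact hTS n (s i).2
  refine ⟨M, ?_, ?_, le_antisymm ?_ ?_⟩
  · obtain ⟨R, hR⟩ : ∃ R : ℕ, ∀ i k j, ((s i : PauliModule p q) k).coeff j ≠ 0 → j.natAbs ≤ R := by
      refine ⟨∑ i, ∑ k, ∑ j ∈ ((s i : PauliModule p q) k).coeff.support, j.natAbs,
        fun i k j hj => ?_⟩
      calc j.natAbs ≤ ∑ j ∈ ((s i : PauliModule p q) k).coeff.support, j.natAbs :=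
            Finset.single_le_sum (f := Int.natAbs) (fun _ _ => Nat.zero_le _)
              (Finsupp.mem_support_iff.2 hj)
        _ ≤ ∑ k, ∑ j ∈ ((s i : PauliModule p q) k).coeff.support, j.natAbs :=
            Finset.single_le_sum
              (f := fun k => ∑ j ∈ ((s i : PauliModule p q) k).coeff.support, j.natAbs)
              (fun _ _ => Nat.zero_le _) (Finset.mem_univ k)
        _ ≤ _ := Finset.single_le_sum
              (f := fun i => ∑ k, ∑ j ∈ ((s i : PauliModule p q) k).coeff.support, j.natAbs)
              (fun _ _ => Nat.zero_le _) (Finset.mem_univ i)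
    -- All generators `s i` are supported in `[-R, R]`; a translate by `b * n` lies in `[b * n - R,
    -- b * n + R]`.
    refine ⟨2 * R, ?_⟩
    rintro U ⟨hU, u, rfl | ⟨n, i, rfl⟩, c, hc, h⟩
    · exact ⟨0, mem_pauliOn_of_isWeyl ⟨0, by simp⟩ hU h fun k j hj => absurd rfl hj⟩
    · refine ⟨b * n - R, mem_pauliOn_of_isWeyl ⟨b * n, by simp; omega⟩ hU h fun k j hj => ?_⟩
      rw [Pi.smul_apply, smul_eq_mul, coeff_T_mul] at hj
      have := hR i k _ hj
      simp only [Set.mem_Icc]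
      push_cast
      omega
  · rintro n U ⟨hU, u, hu, c, hc, h⟩
    refine ⟨translate_mem_pauliGroup _ hU, _, ?_, c, hc, h.translate _⟩
    rcases hu with rfl | ⟨l, i, rfl⟩
    · exact Or.inl (smul_zero _)
    · refine Or.inr ⟨n + l, i, ?_⟩
      rw [smul_smul, ← T_add, mul_add]
  · rw [Subgroup.closure_le]
    rintro U ⟨hU, u, hu, h⟩
    exact ⟨hU, u, hES u hu, h⟩
  · rintro U ⟨hU, u, hu, c, hc, h⟩
    have hM0 : ∀ V ∈ pauliGroup p q Γ, ∀ d : ℂ, d ≠ 0 → IsWeyl V 0 d →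
        V ∈ Subgroup.closure M := fun V hV d hd h =>
      Subgroup.subset_closure ⟨hV, 0, Or.inl rfl, d, hd, h⟩
    have hMP : Subgroup.closure M ≤ pauliGroup p q Γ := by
      rw [Subgroup.closure_le]; exact fun V hV => hV.1
    have hE : ∀ u ∈ E, u ∈ weylVectors (Subgroup.closure M) := by
      intro u hu
      obtain ⟨V, hV, d, hd, hVd⟩ := mem_weylVectors_pauliOn (Γ := Γ) (I := Set.univ) (u := u)
        fun _ _ _ => trivial
      exact ⟨V, Subgroup.subset_closure ⟨hV, u, hu, d, hd, hVd⟩, d, hd, hVd⟩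
    have hu' : u ∈ weylVectors (Subgroup.closure M) := by
      have h1 : (⟨u, hu⟩ : S) ∈ Submodule.span (coarseRing p b) (Set.range s) := by
        rw [hs]; trivial
      obtain ⟨a, ha⟩ := (Submodule.mem_span_range_iff_exists_fun _).1 h1
      have h2 : u = ∑ i, a i • (s i : PauliModule p q) := by
        have := congrArg S.subtype ha
        rw [map_sum] at this
        exact this.symm
      rw [h2]
      refine AddSubgroup.sum_mem _ fun i _ => ?_
      obtain ⟨e, he⟩ := exists_expand_eq (a i).2
      -- On the coarsened module, closure under translations by multiples of `b` becomes closure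
      -- under all powers of `T`, so `AddSubgroup.laurent_smul_mem` applies.
      have h3 : e • Coarsened.of b (s i : PauliModule p q) ∈
          (weylVectors (Subgroup.closure M)).map (Coarsened.of b).toAddMonoidHom :=
        AddSubgroup.laurent_smul_mem _ (fun n => by
          rw [Coarsened.T_smul_of]
          exact ⟨_, hE _ (Or.inr ⟨n, i, rfl⟩), rfl⟩) e
      obtain ⟨x, hx, hxe⟩ := h3
      have h4 : x = a i • (s i : PauliModule p q) := by
        have h5 : a i • (s i : PauliModule p q) = expand b e • (s i : PauliModule p q) := by
          rw [he]; rfl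
        rw [h5]; exact hxe
      rwa [← h4]
    obtain ⟨V, hV, d, hd, hVd⟩ := hu'
    rw [← inv_mul_cancel_right U V]
    exact Subgroup.mul_mem _ (hM0 _ (Subgroup.mul_mem _ hU (Subgroup.inv_mem _ (hMP hV))) _
      (div_ne_zero hc hd) (h.mul_inv_same hVd hd)) hV

end PauliChain

/-! ### The main theorem -/

theorem mainTheorem6 (p : ℕ) [Fact p.Prime] (q : ℕ) :
    (∀ (Γ : Subgroup Circle) (G : Subgroup (PauliChain.Op p q)),
      G ≤ PauliChain.pauliGroup p q Γ →
      PauliChain.IsTranslationInvariant 1 (G : Set (PauliChain.Op p q)) →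
      ∃ S : Subgroup (PauliChain.Op p q),
        S ≤ PauliChain.pauliGroup p q Γ ∧
        S ≤ Subgroup.centralizer (G : Set (PauliChain.Op p q)) ∧
        (∀ U ∈ S, ∀ V ∈ S, U * V = V * U) ∧
        (∃ b : ℕ, 1 ≤ b ∧ ∃ M : Set (PauliChain.Op p q),
          PauliChain.IsLocalPauliSet Γ M ∧
          PauliChain.IsTranslationInvariant b M ∧
          Subgroup.closure M = S) ∧
        (∀ U ∈ PauliChain.pauliGroup p q Γ,
          (∀ V ∈ S, U * V = V * U) → (∀ V ∈ G, U * V = V * U) → U ∈ S)) ∧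
    (∀ A : Submodule (LaurentPolynomial (ZMod p)) (PauliChain.PauliModule p q),
      ∃ b : ℕ, 1 ≤ b ∧
        ∃ S : Submodule (PauliChain.coarseRing p b) (PauliChain.PauliModule p q),
          Module.Free (PauliChain.coarseRing p b) S ∧
          (S : Set (PauliChain.PauliModule p q)) ⊆
            PauliChain.perp (A : Set (PauliChain.PauliModule p q)) ∧
          PauliChain.perp (S : Set (PauliChain.PauliModule p q)) ∩
              PauliChain.perp (A : Set (PauliChain.PauliModule p q)) =
            (S : Set (PauliChain.PauliModule p q))) := by
  refine ⟨fun Γ G hGP hG => ?_, fun A => ?_⟩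
  · obtain ⟨b, hb, S, hSA, hS⟩ :=
      PauliChain.exists_lagrangian_perp (PauliChain.vectorModule G hG)
    have := (PauliChain.free_and_finite_coarseRing hb S).2
    have hwG : ∀ V ∈ G, ∃ v ∈ PauliChain.vectorModule G hG, ∃ d : ℂ, d ≠ 0 ∧
        PauliChain.IsWeyl V v d := by
      intro V hV
      obtain ⟨v, d, hd, h, -⟩ :=
        PauliChain.exists_isWeyl_of_mem_pauliGroup Set.univ_nonempty (hGP hV)
      exact ⟨v, ⟨V, hV, d, hd, h⟩, d, hd, h⟩
    refine ⟨PauliChain.pauliWithVectors Γ S.toAddSubgroup, fun U hU => hU.1, ?_, ?_,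
      ⟨b, hb, PauliChain.exists_local_generators S⟩, ?_⟩
    · rintro U ⟨-, u, hu, c, hc, hU⟩
      rw [Subgroup.mem_centralizer_iff]
      intro V hV
      obtain ⟨v, hv, d, hd, hVd⟩ := hwG V hV
      exact (hVd.commute_iff hU hd hc).2 (hSA hu v hv)
    · rintro U ⟨-, u, hu, c, hc, hU⟩ V ⟨-, v, hv, d, hd, hV⟩
      have hv' : v ∈ PauliChain.perp (S : Set (PauliChain.PauliModule p q)) :=
        (hS.ge hv).1
      exact (hU.commute_iff hV hc hd).2 (hv' u hu)
    · intro U hU hUS hUG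
      obtain ⟨u, c, hc, h, -⟩ :=
        PauliChain.exists_isWeyl_of_mem_pauliGroup Set.univ_nonempty hU
      refine ⟨hU, u, ?_, c, hc, h⟩
      change u ∈ (S : Set (PauliChain.PauliModule p q))
      -- Each vector of `S` and of `G` comes from an operator that commutes with `U`, which puts `u`
      -- in both complements.
      rw [← hS]
      constructor
      · intro v hv
        obtain ⟨V, hV, d, hd, hVd⟩ := PauliChain.exists_mem_pauliWithVectors (Γ := Γ)
          (W := S.toAddSubgroup) hv
        exact (hVd.commute_iff h hd hc).1 (hUS V hV).symm
      · rintro v ⟨V, hV, d, hd, hVd⟩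
        exact (hVd.commute_iff h hd hc).1 (hUG V hV).symm
  · obtain ⟨b, hb, S, hSA, hS⟩ := PauliChain.exists_lagrangian_perp A
    exact ⟨b, hb, S, (PauliChain.free_and_finite_coarseRing hb S).1, hSA, hS⟩
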